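/- Let $d\ge 1$ and let $(X_u)_{u\in\mathbb Z^d}$ be a stationary random field of mean-zero, finite-variance real random variables which satisfies the FKG inequalities: for every finite subfamily $(X_{u_1},\dots,X_{u_m})$ and all coordinatewise nondecreasing functions $F,G$ for which $F(X_{u_1},\dots,X_{u_m})$ and $G(X_{u_1},\dots,X_{u_m})$ have finite second moments, $\mathrm{Cov}(F(X_{u_1},\dots,X_{u_m}),G(X_{u_1},\dots,X_{u_m}))\ge 0$. Assume finite susceptibility: $\sum_{u\in\mathbb Z^d}\mathrm{Cov}(X_0,X_u)<\infty$. Fix $\tau>0$ and let $(Z_u)_{u\in\mathbb Z^d}$ be $N(0,\tau)$ random variables independent of the field $X$ and of each other. For $x\in\{1,2,\dots\}^d$ let $B_x=\{y\in\mathbb Z^d: 1\le y_i\le x_i \text{ for all } i\}$, $|x|=|B_x|=\prod_i x_i$, and $$V_x=\frac1{\sqrt{|x|}}\sum_{u\in B_x}(X_u+Z_u).$$ For a random variable $U$ with variance $\sigma^2$ and smooth density $f$, let $J_{\rm st}(U)=\sigma^2\,\mathbb E\big[(f'(U)/f(U))^2\big]-1$ be its standardised Fisher information. Then $$\lim_{n\to\infty}\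 \sup_{x:\,|x|=n} J_{\rm st}(V_x)=0$$ if and only if the family $(V_x)$ is uniformly integrable in the following sense: there exists a function $\psi:\mathbb R\to\mathbb R$ with $\psi(R)\to0$ as $R\to\infty$ such that, for all $x\in\{1,2,\dots\}^d$ and all $R$, $$\mathbb E\big[V_x^2\,\mathbf 1(|V_x|\ge R\,\sigma_x)\big]\le\sigma_x^2\,\psi(R),\qquad \sigma_x^2=\mathrm{Var}(V_x).$$ -/

import Mathlib

open MeasureTheory ProbabilityTheory Filter Topology
open scoped NNReal ENNReal

noncomputable section

namespace FKGField

/-- `f` is a (version of the) continuously differentiable Lebesgue density of the law `μ` on `ℝ`.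
Such an `f`, if it exists, is unique. -/
structure IsSmoothDensity (f : ℝ → ℝ) (μ : Measure ℝ) : Prop where
  contDiff : ContDiff ℝ 1 f
  nonneg : ∀ x, 0 ≤ f x
  eq_withDensity : μ = volume.withDensity (fun x => ENNReal.ofReal (f x))

/-- The score function `ρ = f' / f` of a density `f`. -/
def score (f : ℝ → ℝ) (x : ℝ) : ℝ := deriv f x / f x

/-- The Fisher information `J(U) = E ρ(U)²`, with values in `[0, ∞]`. As the smooth density of `U`
is unique, the infimum is over at most one function; `J(U) = ∞` if there is no smooth density. -/
def fisherInfo {Ω : Type*} [MeasurableSpace Ω] (U : Ω → ℝ) (P : Measure Ω) : ℝ≥0∞ :=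
  ⨅ (f : ℝ → ℝ) (_ : IsSmoothDensity f (P.map U)), ∫⁻ ω, ENNReal.ofReal (score f (U ω) ^ 2) ∂P

/-- The standardised Fisher information `J_st(U) = σ² J(U) - 1`, where `σ² = Var U`. -/
def stdFisherInfo {Ω : Type*} [MeasurableSpace Ω] (U : Ω → ℝ) (P : Measure Ω) : EReal :=
  ((ENNReal.ofReal (Var[U; P]) * fisherInfo U P : ℝ≥0∞) : EReal) - 1

/-- The FKG property of a family of random variables: for every finite subfamily, coordinatewise
nondecreasing (Borel) functions of it have nonnegative covariance, whenever they have finite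
second moments. -/
def IsFKG {ι Ω : Type*} [MeasurableSpace Ω] (X : ι → Ω → ℝ) (P : Measure Ω) : Prop :=
  ∀ (s : Finset ι) (F G : (s → ℝ) → ℝ), Monotone F → Monotone G → Measurable F → Measurable G →
    MemLp (fun ω => F (fun i => X i ω)) 2 P → MemLp (fun ω => G (fun i => X i ω)) 2 P →
    0 ≤ cov[fun ω => F (fun i => X i ω), fun ω => G (fun i => X i ω); P]

/-- Stationarity of a random field on `ℤ^d`: all translates have the same joint law. -/
def IsStationary {d : ℕ} {Ω : Type*} [MeasurableSpace Ω] (X : (Fin d → ℤ) → Ω → ℝ)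
    (P : Measure Ω) : Prop :=
  ∀ a : Fin d → ℤ,
    P.map (fun ω (u : Fin d → ℤ) => X (u + a) ω) = P.map (fun ω (u : Fin d → ℤ) => X u ω)

/-- The box `{y ∈ ℤ^d : 1 ≤ y_i ≤ x_i for all i}` with side lengths `x_i`. -/
def box {d : ℕ} (x : Fin d → ℕ) : Finset (Fin d → ℤ) :=
  Fintype.piFinset fun i => Finset.Icc 1 (x i : ℤ)

/-- The volume `∏ x_i` of a box. -/
def boxVolume {d : ℕ} (x : Fin d → ℕ) : ℕ := ∏ i, x i

theorem card_box {d : ℕ} (x : Fin d → ℕ) : (box x).card = boxVolume x := by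
  simp [box, boxVolume]

/-- The normalised perturbed sum `V_x = |x|^{-1/2} ∑_{u ∈ B_x} (X_u + Z_u)`. -/
def perturbedSum {d : ℕ} {Ω : Type*} (X Z : (Fin d → ℤ) → Ω → ℝ) (x : Fin d → ℕ) (ω : Ω) : ℝ :=
  (∑ u ∈ box x, (X u ω + Z u ω)) / √(boxVolume x : ℝ)

/-- The class `C_ψ`: `U` has finite variance `σ²`, and
`E U² 1(|U| ≥ R σ) ≤ σ² ψ(R)` for all `R`. -/
def MemClass {Ω : Type*} [MeasurableSpace Ω] (ψ : ℝ → ℝ) (U : Ω → ℝ) (P : Measure Ω) : Prop :=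
  MemLp U 2 P ∧
    ∀ R : ℝ, ∫ ω in {ω | R * √(Var[U; P]) ≤ |U ω|}, U ω ^ 2 ∂P ≤ Var[U; P] * ψ R

end FKGField

end

/-! Both sides of the equivalence hold for every field of this kind; each follows from Newman's
central limit theorem for boxes of growing volume and arbitrary shape.

For the central limit theorem, nonnegative covariances and finite susceptibility keep the variance
per site in a compact interval, so along an ultrafilter of growing boxes it has some limit `s`,
which may depend on the shapes. Choose a box `y` typical for the ultrafilter: its variance per site
is close to `s`, and each side of the running box `x` either tends to infinity or is eventually
equal to that of `y`. Tile `x` by translates of `y`. All errors are controlled by one quantity, the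
variance of the sum over `x` minus the variances of the block sums: it bounds the variance of the
untiled remainder, and through Newman's inequality (`IsFKG.norm_charFun_sum_sub_prod_le`) the
distance from independent blocks. Per site it tends to `s` minus the variance per site of `y`, which
is small. Independent copies of a fixed block obey the classical theorem.

For Fisher information, the law of the perturbed sum is a Gaussian smoothing. Weak convergence makes
its density and the derivative of that density converge pointwise. By Cauchy–Schwarz the integrand
`f' ^ 2 / f` is dominated by a smoothed kernel of constant total mass `1 / τ`, so the Fisher
information tends to `1 / (s + τ)`, while the variance tends to `s + τ`. The product tends to `1`
whatever `s` is.

For uniform integrability, the standardised sums converge weakly to `N(0, 1)` and have the variance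
of the limit, so no second moment escapes to infinity. Only finitely many boxes have volume below a
given bound, and each has a vanishing tail. -/

namespace FKGField

/-! ### Covariance inequalities for increasing functions of an FKG field -/

section Newman

variable {ι Ω : Type*} {X : ι → Ω → ℝ}

/-- `U` is a coordinatewise nondecreasing Borel function of finitely many of the `X i`. -/
def IsIncreasing (X : ι → Ω → ℝ) (U : Ω → ℝ) : Prop :=
  ∃ (s : Finset ι) (F : (s → ℝ) → ℝ), Monotone F ∧ Measurable F ∧
    ∀ ω, U ω = F (fun i => X i ω)

theorem IsIncreasing.exists_of_subset {U : Ω → ℝ} {s : Finset ι} {F : (s → ℝ) → ℝ}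
    (hF : Monotone F) (hFm : Measurable F) (hU : ∀ ω, U ω = F (fun i => X i ω))
    {t : Finset ι} (hst : s ⊆ t) :
    ∃ G : (t → ℝ) → ℝ, Monotone G ∧ Measurable G ∧ ∀ ω, U ω = G (fun i => X i ω) := by
  refine ⟨fun z => F (fun i => z ⟨i, hst i.2⟩), fun z w hzw => hF fun i => hzw _, ?_, hU⟩
  exact hFm.comp (measurable_pi_lambda _ fun i => measurable_pi_apply _)

theorem IsIncreasing.exists_common {U V : Ω → ℝ} (hU : IsIncreasing X U)
    (hV : IsIncreasing X V) :
    ∃ (s : Finset ι) (F G : (s → ℝ) → ℝ), Monotone F ∧ Measurable F ∧ Monotone G ∧ Measurable G ∧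
      (∀ ω, U ω = F (fun i => X i ω)) ∧ ∀ ω, V ω = G (fun i => X i ω) := by
  classical
  obtain ⟨s, F, hF, hFm, hUF⟩ := hU
  obtain ⟨t, G, hG, hGm, hVG⟩ := hV
  obtain ⟨F', h1, h2, h3⟩ := exists_of_subset hF hFm hUF (Finset.subset_union_left (s₂ := t))
  obtain ⟨G', h4, h5, h6⟩ := exists_of_subset hG hGm hVG (Finset.subset_union_right (s₁ := s))
  exact ⟨s ∪ t, F', G', h1, h2, h4, h5, h3, h6⟩

theorem isIncreasing_apply (i : ι) : IsIncreasing X (X i) :=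
  ⟨{i}, fun z => z ⟨i, by simp⟩, fun z w h => h _, measurable_pi_apply _, fun _ => rfl⟩

theorem isIncreasing_zero : IsIncreasing X (fun _ => (0 : ℝ)) :=
  ⟨∅, fun _ => 0, monotone_const, measurable_const, fun _ => rfl⟩

theorem IsIncreasing.add {U V : Ω → ℝ} (hU : IsIncreasing X U) (hV : IsIncreasing X V) :
    IsIncreasing X (fun ω => U ω + V ω) := by
  obtain ⟨s, F, G, hF, hFm, hG, hGm, h1, h2⟩ := hU.exists_common hV
  exact ⟨s, fun z => F z + G z, hF.add hG, hFm.add hGm, fun ω => by simp only [h1, h2]⟩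

theorem IsIncreasing.comp {U : Ω → ℝ} (hU : IsIncreasing X U) {g : ℝ → ℝ} (hg : Monotone g) :
    IsIncreasing X (fun ω => g (U ω)) := by
  obtain ⟨s, F, hF, hFm, h⟩ := hU
  exact ⟨s, fun z => g (F z), hg.comp hF, hg.measurable.comp hFm, fun ω => by simp only [h]⟩

theorem isIncreasing_sum {α : Type*} (Q : Finset α) {U : α → Ω → ℝ}
    (hU : ∀ a ∈ Q, IsIncreasing X (U a)) : IsIncreasing X (fun ω => ∑ a ∈ Q, U a ω) := by
  classical
  induction Q using Finset.induction_on with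
  | empty => simpa using isIncreasing_zero
  | insert b Q hb ih =>
    simp_rw [Finset.sum_insert hb]
    exact (hU b (by simp)).add (ih fun a ha => hU a (by simp [ha]))

variable [MeasurableSpace Ω] {P : Measure Ω}

theorem IsFKG.cov_nonneg (hX : IsFKG X P) {U V : Ω → ℝ} (hU : IsIncreasing X U)
    (hV : IsIncreasing X V) (hU2 : MemLp U 2 P) (hV2 : MemLp V 2 P) : 0 ≤ cov[U, V; P] := by
  obtain ⟨s, F, G, hF, hFm, hG, hGm, h1, h2⟩ := hU.exists_common hV
  obtain rfl := funext h1
  obtain rfl := funext h2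
  exact hX s F G hF hG hFm hGm hU2 hV2

variable [IsProbabilityMeasure P]

/-- Lipschitz functions of increasing functions of an FKG field are at most as correlated as
the increasing functions themselves. -/
theorem IsFKG.abs_cov_comp_le (hX : IsFKG X P) {U V : Ω → ℝ} (hU : IsIncreasing X U)
    (hV : IsIncreasing X V) (hU2 : MemLp U 2 P) (hV2 : MemLp V 2 P) {f g : ℝ → ℝ} {K : ℝ}
    (hf : ∀ a b, a ≤ b → |f b - f a| ≤ K * (b - a)) (hg : ∀ a b, a ≤ b → |g b - g a| ≤ K * (b - a))
    (hfU : MemLp (fun ω => f (U ω)) 2 P) (hgV : MemLp (fun ω => g (V ω)) 2 P) :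
    |cov[fun ω => f (U ω), fun ω => g (V ω); P]| ≤ K ^ 2 * cov[U, V; P] := by
  -- A `K`-Lipschitz function becomes nondecreasing when added to or subtracted from `K * x`. Among
  -- the four resulting FKG inequalities, the two with equal signs add up to the lower bound and the
  -- two with opposite signs to the upper bound; the cross terms cancel.
  have mono_add : ∀ h : ℝ → ℝ, (∀ a b, a ≤ b → |h b - h a| ≤ K * (b - a)) →
      Monotone fun x => K * x + h x := fun h hh a b hab => by
    have := neg_le_of_abs_le (hh a b hab); dsimp only; linarith
  have mono_sub : ∀ h : ℝ → ℝ, (∀ a b, a ≤ b → |h b - h a| ≤ K * (b - a)) →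
      Monotone fun x => K * x - h x := fun h hh a b hab => by
    have := le_of_abs_le (hh a b hab); dsimp only; linarith
  have hKU : MemLp (fun ω => K * U ω) 2 P := hU2.const_mul K
  have hKV : MemLp (fun ω => K * V ω) 2 P := hV2.const_mul K
  have cadd : ∀ {A B C : Ω → ℝ}, MemLp A 2 P → MemLp B 2 P → MemLp C 2 P →
      cov[fun ω => A ω + B ω, C; P] = cov[A, C; P] + cov[B, C; P] :=
    fun hA hB hC => covariance_add_left hA hB hC
  have caddr : ∀ {A B C : Ω → ℝ}, MemLp A 2 P → MemLp B 2 P → MemLp C 2 P →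
      cov[C, fun ω => A ω + B ω; P] = cov[C, A; P] + cov[C, B; P] :=
    fun hA hB hC => covariance_add_right hC hA hB
  have h1 := hX.cov_nonneg (hU.comp (mono_add f hf)) (hV.comp (mono_add g hg))
    (hKU.add hfU) (hKV.add hgV)
  have h2 := hX.cov_nonneg (hU.comp (mono_sub f hf)) (hV.comp (mono_sub g hg))
    (hKU.sub hfU) (hKV.sub hgV)
  have h3 := hX.cov_nonneg (hU.comp (mono_add f hf)) (hV.comp (mono_sub g hg))
    (hKU.add hfU) (hKV.sub hgV)
  have h4 := hX.cov_nonneg (hU.comp (mono_sub f hf)) (hV.comp (mono_add g hg))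
    (hKU.sub hfU) (hKV.add hgV)
  have hVadd : MemLp (fun ω => K * V ω + g (V ω)) 2 P := hKV.add hgV
  have hVsub : MemLp (fun ω => K * V ω - g (V ω)) 2 P := hKV.sub hgV
  rw [cadd hKU hfU hVadd, caddr hKV hgV hKU, caddr hKV hgV hfU] at h1
  rw [covariance_fun_sub_left hKU hfU hVsub, covariance_fun_sub_right hKU hKV hgV,
    covariance_fun_sub_right hfU hKV hgV] at h2
  rw [cadd hKU hfU hVsub, covariance_fun_sub_right hKU hKV hgV,
    covariance_fun_sub_right hfU hKV hgV] at h3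
  rw [covariance_fun_sub_left hKU hfU hVadd, caddr hKV hgV hKU, caddr hKV hgV hfU] at h4
  have hK : cov[fun ω => K * U ω, fun ω => K * V ω; P] = K ^ 2 * cov[U, V; P] := by
    rw [covariance_const_mul_left, covariance_const_mul_right]; ring
  rw [hK] at h1 h2 h3 h4
  rw [abs_le]; constructor <;> linarith

theorem charFun_map_eq_cos_add_sin {U : Ω → ℝ} (hU : AEMeasurable U P) (t : ℝ) :
    charFun (P.map U) t =
      ((∫ ω, Real.cos (t * U ω) ∂P : ℝ) : ℂ) + ((∫ ω, Real.sin (t * U ω) ∂P : ℝ) : ℂ) * Complex.I := by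
  rw [charFun_apply_real, integral_map hU (by fun_prop), ← integral_complex_ofReal,
    ← integral_complex_ofReal, ← integral_mul_const, ← integral_add]
  · refine integral_congr_ae (ae_of_all _ fun ω => ?_)
    dsimp only
    rw [← Complex.ofReal_mul, Complex.exp_mul_I, Complex.ofReal_cos, Complex.ofReal_sin]
  · refine Integrable.of_bound (C := 1) (by fun_prop) (ae_of_all _ fun ω => ?_)
    rw [Complex.norm_real]; exact Real.abs_cos_le_one _
  · refine Integrable.of_bound (C := 1) (by fun_prop) (ae_of_all _ fun ω => ?_)
    rw [norm_mul, Complex.norm_I, mul_one, Complex.norm_real]; exact Real.abs_sin_le_one _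

theorem memLp_cos_mul {U : Ω → ℝ} (hU : AEMeasurable U P) (t : ℝ) :
    MemLp (fun ω => Real.cos (t * U ω)) 2 P :=
  .of_bound (C := 1) (by fun_prop) (ae_of_all _ fun _ => Real.abs_cos_le_one _)

theorem memLp_sin_mul {U : Ω → ℝ} (hU : AEMeasurable U P) (t : ℝ) :
    MemLp (fun ω => Real.sin (t * U ω)) 2 P :=
  .of_bound (C := 1) (by fun_prop) (ae_of_all _ fun _ => Real.abs_sin_le_one _)

/-- The addition formulas for sine and cosine express the failure of factorisation through
covariances of Lipschitz functions, to which `IsFKG.abs_cov_comp_le` applies. -/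
theorem charFun_map_add_sub_mul {U V : Ω → ℝ} (hU : AEMeasurable U P) (hV : AEMeasurable V P)
    (t : ℝ) :
    charFun (P.map fun ω => U ω + V ω) t - charFun (P.map U) t * charFun (P.map V) t =
      ((cov[fun ω => Real.cos (t * U ω), fun ω => Real.cos (t * V ω); P]
        - cov[fun ω => Real.sin (t * U ω), fun ω => Real.sin (t * V ω); P] : ℝ) : ℂ)
      + ((cov[fun ω => Real.sin (t * U ω), fun ω => Real.cos (t * V ω); P]
        + cov[fun ω => Real.cos (t * U ω), fun ω => Real.sin (t * V ω); P] : ℝ) : ℂ)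
        * Complex.I := by
  have cU := memLp_cos_mul hU t
  have cV := memLp_cos_mul hV t
  have sU := memLp_sin_mul hU t
  have sV := memLp_sin_mul hV t
  rw [covariance_eq_sub cU cV, covariance_eq_sub sU sV, covariance_eq_sub sU cV,
    covariance_eq_sub cU sV, charFun_map_eq_cos_add_sin (by fun_prop),
    charFun_map_eq_cos_add_sin hU, charFun_map_eq_cos_add_sin hV]
  have e1 : ∫ ω, Real.cos (t * (U ω + V ω)) ∂P =
      (∫ ω, Real.cos (t * U ω) * Real.cos (t * V ω) ∂P)
        - ∫ ω, Real.sin (t * U ω) * Real.sin (t * V ω) ∂P := by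
    simp_rw [mul_add, Real.cos_add]
    exact integral_sub (cU.integrable_mul cV) (sU.integrable_mul sV)
  have e2 : ∫ ω, Real.sin (t * (U ω + V ω)) ∂P =
      (∫ ω, Real.sin (t * U ω) * Real.cos (t * V ω) ∂P)
        + ∫ ω, Real.cos (t * U ω) * Real.sin (t * V ω) ∂P := by
    simp_rw [mul_add, Real.sin_add]
    exact integral_add (sU.integrable_mul cV) (cU.integrable_mul sV)
  rw [e1, e2]
  simp only [Pi.mul_apply]
  push_cast
  ring_nf
  rw [Complex.I_sq]
  ring

/-- Each of the four sine and cosine covariances costs at most `t ^ 2 * cov[U, V; P]`, since `sin (t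
* ·)` and `cos (t * ·)` are `|t|`-Lipschitz. -/
theorem IsFKG.norm_charFun_add_sub_mul_le (hX : IsFKG X P) {U V : Ω → ℝ} (hU : IsIncreasing X U)
    (hV : IsIncreasing X V) (hU2 : MemLp U 2 P) (hV2 : MemLp V 2 P) (t : ℝ) :
    ‖charFun (P.map fun ω => U ω + V ω) t - charFun (P.map U) t * charFun (P.map V) t‖ ≤
      4 * t ^ 2 * cov[U, V; P] := by
  have mU := hU2.aestronglyMeasurable.aemeasurable
  have mV := hV2.aestronglyMeasurable.aemeasurable
  have hc : ∀ a b : ℝ, a ≤ b → |Real.cos (t * b) - Real.cos (t * a)| ≤ |t| * (b - a) := by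
    intro a b hab
    refine (Real.abs_cos_sub_cos_le _ _).trans ?_
    rw [← mul_sub, abs_mul, abs_of_nonneg (sub_nonneg.2 hab)]
  have hs : ∀ a b : ℝ, a ≤ b → |Real.sin (t * b) - Real.sin (t * a)| ≤ |t| * (b - a) := by
    intro a b hab
    refine (Real.abs_sin_sub_sin_le _ _).trans ?_
    rw [← mul_sub, abs_mul, abs_of_nonneg (sub_nonneg.2 hab)]
  have cU := memLp_cos_mul mU t
  have cV := memLp_cos_mul mV t
  have sU := memLp_sin_mul mU t
  have sV := memLp_sin_mul mV t
  have h1 := hX.abs_cov_comp_le hU hV hU2 hV2 hc hc cU cV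
  have h2 := hX.abs_cov_comp_le hU hV hU2 hV2 hs hs sU sV
  have h3 := hX.abs_cov_comp_le hU hV hU2 hV2 hs hc sU cV
  have h4 := hX.abs_cov_comp_le hU hV hU2 hV2 hc hs cU sV
  rw [sq_abs] at h1 h2 h3 h4
  rw [charFun_map_add_sub_mul mU mV]
  refine (norm_add_le _ _).trans ?_
  rw [norm_mul, Complex.norm_I, mul_one, Complex.norm_real, Complex.norm_real]
  refine (add_le_add (norm_sub_le _ _) (norm_add_le _ _)).trans ?_
  simp only [Real.norm_eq_abs]
  linarith

/-- **Newman's inequality**: the characteristic function of a sum of increasing functions of an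
FKG field is close to the product of the characteristic functions, with an error controlled by
the covariances. -/
theorem IsFKG.norm_charFun_sum_sub_prod_le (hX : IsFKG X P) {α : Type*} (Q : Finset α)
    {U : α → Ω → ℝ} (hU : ∀ a, IsIncreasing X (U a)) (hU2 : ∀ a, MemLp (U a) 2 P) (t : ℝ) :
    ‖charFun (P.map fun ω => ∑ a ∈ Q, U a ω) t - ∏ a ∈ Q, charFun (P.map (U a)) t‖ ≤
      2 * t ^ 2 * (Var[fun ω => ∑ a ∈ Q, U a ω; P] - ∑ a ∈ Q, Var[U a; P]) := by
  classical
  induction Q using Finset.induction_on with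
  | empty =>
    have : Var[fun _ : Ω => (0 : ℝ); P] = 0 := variance_zero P
    simp [this]
  | insert b Q hb ih =>
    have hS : MemLp (fun ω => ∑ a ∈ Q, U a ω) 2 P := memLp_finsetSum Q fun a _ => hU2 a
    have hSi : IsIncreasing X (fun ω => ∑ a ∈ Q, U a ω) := isIncreasing_sum Q fun a _ => hU a
    simp_rw [Finset.sum_insert hb, Finset.prod_insert hb]
    -- The variance gains `2 * cov` beyond the individual variances, so the new error `4 * t ^ 2 *
    -- cov` is exactly the increment of the right-hand side.
    rw [variance_fun_add (hU2 b) hS]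
    have h1 := hX.norm_charFun_add_sub_mul_le (hU b) hSi (hU2 b) hS t
    have mb : IsProbabilityMeasure (P.map (U b)) :=
      Measure.isProbabilityMeasure_map (hU2 b).aestronglyMeasurable.aemeasurable
    have h2 : ‖charFun (P.map (U b)) t * (charFun (P.map fun ω => ∑ a ∈ Q, U a ω) t
        - ∏ a ∈ Q, charFun (P.map (U a)) t)‖ ≤
        2 * t ^ 2 * (Var[fun ω => ∑ a ∈ Q, U a ω; P] - ∑ a ∈ Q, Var[U a; P]) := by
      rw [norm_mul]
      exact (mul_le_of_le_one_left (norm_nonneg _) (norm_charFun_le_one t)).trans ih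
    have h3 := norm_add_le_of_le h1 h2
    rw [mul_sub, sub_add_sub_cancel] at h3
    linarith

end Newman

/-! ### Estimates for characteristic functions -/

section CharFun

variable {Ω : Type*} [MeasurableSpace Ω] {P : Measure Ω} [IsProbabilityMeasure P]

theorem integral_abs_le_sqrt_variance {R : Ω → ℝ} (hR : MemLp R 2 P) (h0 : ∫ ω, R ω ∂P = 0) :
    ∫ ω, |R ω| ∂P ≤ √(Var[R; P]) := by
  have h := variance_nonneg |R| P
  rw [variance_eq_sub hR.abs] at h
  have h2 := variance_eq_sub hR
  rw [h0] at h2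
  refine Real.le_sqrt_of_sq_le ?_
  rw [h2]
  simp only [Pi.pow_apply, Pi.abs_apply, sq_abs] at h ⊢
  linarith

/-- Since `|exp (i a) - exp (i b)| ≤ |a - b|`, the difference is at most a first absolute moment,
hence a standard deviation. With `t = s` this removes a remainder; with `A = B` it moves the
argument. -/
theorem norm_charFun_sub_charFun_le {A B : Ω → ℝ} (hA : MemLp A 2 P) (hB : MemLp B 2 P)
    (hA0 : ∫ ω, A ω ∂P = 0) (hB0 : ∫ ω, B ω ∂P = 0) (t s : ℝ) :
    ‖charFun (P.map A) t - charFun (P.map B) s‖ ≤ √(Var[fun ω => t * A ω - s * B ω; P]) := by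
  have mA := hA.aestronglyMeasurable.aemeasurable
  have mB := hB.aestronglyMeasurable.aemeasurable
  have iA := hA.integrable one_le_two
  have iB := hB.integrable one_le_two
  have hD : MemLp (fun ω => t * A ω - s * B ω) 2 P := (hA.const_mul t).sub (hB.const_mul s)
  refine le_trans ?_ (integral_abs_le_sqrt_variance hD ?_)
  · rw [charFun_apply_real, charFun_apply_real, integral_map mA (by fun_prop),
      integral_map mB (by fun_prop), ← integral_sub]
    · refine norm_integral_le_of_norm_le (hD.integrable one_le_two).abs (ae_of_all _ fun ω => ?_)
      have := Real.norm_exp_I_mul_ofReal_sub_one_le (x := t * A ω - s * B ω)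
      have e : Complex.exp (t * A ω * Complex.I) - Complex.exp (s * B ω * Complex.I) =
          Complex.exp ((s * B ω : ℝ) * Complex.I) *
            (Complex.exp (Complex.I * (t * A ω - s * B ω : ℝ)) - 1) := by
        rw [mul_sub, ← Complex.exp_add, mul_one]
        push_cast
        ring_nf
      rw [e, norm_mul, Complex.norm_exp_ofReal_mul_I, one_mul]
      exact this
    · refine Integrable.of_bound (C := 1) (by fun_prop) (ae_of_all _ fun ω => ?_)
      rw [← Complex.ofReal_mul, Complex.norm_exp_ofReal_mul_I]
    · refine Integrable.of_bound (C := 1) (by fun_prop) (ae_of_all _ fun ω => ?_)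
      rw [← Complex.ofReal_mul, Complex.norm_exp_ofReal_mul_I]
  · rw [integral_sub (iA.const_mul t) (iB.const_mul s), integral_const_mul, integral_const_mul,
      hA0, hB0]
    simp

/-- To second order at `0`, the characteristic function of a centred law is that of the normal
law with the same variance. -/
theorem charFun_map_sub_exp_isLittleO {A : Ω → ℝ} (hA : MemLp A 2 P) (hA0 : ∫ ω, A ω ∂P = 0) :
    (fun u : ℝ => charFun (P.map A) u - Complex.exp (-(Var[A; P] * u ^ 2 / 2 : ℝ)))
      =o[𝓝 0] fun u => u ^ 2 := by
  -- This expansion is applied to the law of `A` and to the normal law of equal variance (a Dirac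
  -- mass if that is zero); the quadratic polynomials coincide and cancel.
  have taylor : ∀ {μ : Measure ℝ} [IsProbabilityMeasure μ], MemLp id 2 μ → ∫ x, x ∂μ = 0 →
      (fun u : ℝ => charFun μ u - (1 - (∫ x, x ^ 2 ∂μ : ℝ) * u ^ 2 / 2)) =o[𝓝 0]
        fun u => u ^ 2 := by
    intro μ _ hμ h0
    have hμ' : MemLp id 2 (μ.map id) := by simpa using hμ
    have := taylor_isLittleO_univ (n := 2) (x₀ := 0) (contDiff_charFun hμ')
    have e := taylorWithinEval_charFun_two_zero aemeasurable_id hμ'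
    have h0' : ∫ x, id x ∂μ = 0 := h0
    rw [h0'] at e
    simp only [e, sub_zero] at this
    simpa only [Measure.map_id, Complex.ofReal_zero, zero_mul, add_zero, Pi.pow_apply, id]
      using this
  have mA := hA.aestronglyMeasurable.aemeasurable
  have hp : IsProbabilityMeasure (P.map A) := Measure.isProbabilityMeasure_map mA
  have h1 := taylor (μ := P.map A)
    ((memLp_map_measure_iff (by fun_prop) mA).2 (by simpa using hA))
    (by rw [integral_map mA (by fun_prop)]; exact hA0)
  have h2 := taylor (μ := gaussianReal 0 (Var[A; P]).toNNReal)
    (memLp_id_gaussianReal' 2 (by simp)) integral_id_gaussianReal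
  have e1 : ∫ x, x ^ 2 ∂(P.map A) = Var[A; P] := by
    rw [integral_map mA (by fun_prop), variance_of_integral_eq_zero mA hA0]
  have e2 : ∫ x, x ^ 2 ∂(gaussianReal 0 (Var[A; P]).toNNReal) = Var[A; P] := by
    have := variance_of_integral_eq_zero (μ := gaussianReal 0 (Var[A; P]).toNNReal) (X := fun x => x)
      (by fun_prop) integral_id_gaussianReal
    rw [variance_fun_id_gaussianReal, Real.coe_toNNReal _ (variance_nonneg _ _)] at this
    exact this.symm
  rw [e1] at h1
  rw [e2] at h2
  refine (h1.sub h2).congr_left fun u => ?_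
  rw [charFun_gaussianReal, Real.coe_toNNReal _ (variance_nonneg _ _)]
  push_cast
  simp only [mul_zero, zero_mul, zero_sub]
  ring

end CharFun

theorem norm_pow_sub_pow_le {z w : ℂ} (hz : ‖z‖ ≤ 1) (hw : ‖w‖ ≤ 1) (n : ℕ) :
    ‖z ^ n - w ^ n‖ ≤ n * ‖z - w‖ := by
  induction n with
  | zero => simp
  | succ n ih =>
    have e : z ^ (n + 1) - w ^ (n + 1) = z ^ n * (z - w) + (z ^ n - w ^ n) * w := by ring
    rw [e]
    refine (norm_add_le _ _).trans ?_
    rw [norm_mul, norm_mul, norm_pow]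
    have h1 : ‖z‖ ^ n * ‖z - w‖ ≤ ‖z - w‖ :=
      mul_le_of_le_one_left (norm_nonneg _) (pow_le_one₀ (norm_nonneg _) hz)
    have h2 : ‖z ^ n - w ^ n‖ * ‖w‖ ≤ ‖z ^ n - w ^ n‖ :=
      mul_le_of_le_one_right (norm_nonneg _) hw
    push_cast
    linarith

/-! ### Block decomposition of boxes -/

/-- A stationary, centred, square integrable FKG field with finite susceptibility. -/
structure IsFKGSystem {d : ℕ} {Ω : Type*} [MeasurableSpace Ω] (X : (Fin d → ℤ) → Ω → ℝ)
    (P : Measure Ω) : Prop where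
  meas : ∀ u, Measurable (X u)
  stationary : IsStationary X P
  memLp : ∀ u, MemLp (X u) 2 P
  mean : ∀ u, ∫ ω, X u ω ∂P = 0
  fkg : IsFKG X P
  summable : Summable fun u : Fin d → ℤ => cov[X 0, X u; P]

/-- The sum of the field over a box. -/
noncomputable def boxSum {d : ℕ} {Ω : Type*} (X : (Fin d → ℤ) → Ω → ℝ) (x : Fin d → ℕ)
    (ω : Ω) : ℝ := ∑ u ∈ box x, X u ω

/-- The variance of the field over a box, per site. -/
noncomputable def siteVar {d : ℕ} {Ω : Type*} [MeasurableSpace Ω] (X : (Fin d → ℤ) → Ω → ℝ)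
    (P : Measure Ω) (x : Fin d → ℕ) : ℝ := Var[boxSum X x; P] / boxVolume x

/-- The indices of the translates of `box y` that tile `box x` up to a remainder. -/
def blockIndex {d : ℕ} (x y : Fin d → ℕ) : Finset (Fin d → ℕ) :=
  Fintype.piFinset fun i => Finset.range (x i / y i)

/-- The translation taking `box y` to its translate of index `a`. -/
def blockShift {d : ℕ} (y a : Fin d → ℕ) : Fin d → ℤ := fun i => (a i : ℤ) * y i

theorem card_blockIndex {d : ℕ} (x y : Fin d → ℕ) :
    (blockIndex x y).card = ∏ i, x i / y i := by
  simp [blockIndex]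

theorem block_injOn {d : ℕ} (x y : Fin d → ℕ) :
    Set.InjOn (fun p : (Fin d → ℕ) × (Fin d → ℤ) => p.2 + blockShift y p.1)
      (blockIndex x y ×ˢ box y : Finset _) := by
  rintro ⟨a, u⟩ hp ⟨b, v⟩ hq h
  simp only [Finset.coe_product, Set.mem_prod, Finset.mem_coe, box, Fintype.mem_piFinset,
    Finset.mem_Icc] at hp hq
  have key : ∀ i, a i = b i := by
    intro i
    have hi := congrFun h i
    simp only [Pi.add_apply, blockShift] at hi
    have hu := hp.2 i
    have hv := hq.2 i
    rcases lt_trichotomy (a i) (b i) with hlt | heq | hlt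
    · have : (a i : ℤ) + 1 ≤ b i := by exact_mod_cast hlt
      nlinarith
    · exact heq
    · have : (b i : ℤ) + 1 ≤ a i := by exact_mod_cast hlt
      nlinarith
  have hab : a = b := funext key
  subst hab
  simpa using h

theorem block_mem_box {d : ℕ} {x y a : Fin d → ℕ} {u : Fin d → ℤ} (ha : a ∈ blockIndex x y)
    (hu : u ∈ box y) : u + blockShift y a ∈ box x := by
  simp only [box, blockIndex, Fintype.mem_piFinset, Finset.mem_Icc, Finset.mem_range] at *
  intro i
  have h1 := hu i
  have h2 : (a i + 1) * y i ≤ x i :=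
    (Nat.mul_le_mul_right _ (ha i)).trans (Nat.div_mul_le_self _ _)
  have h3 : ((a i : ℤ) + 1) * y i ≤ x i := by exact_mod_cast h2
  have h4 : (0 : ℤ) ≤ a i * y i := by positivity
  simp only [Pi.add_apply, blockShift]
  constructor <;> linarith

theorem boxVolume_pos {d : ℕ} {x : Fin d → ℕ} (hx : ∀ i, 0 < x i) : 0 < boxVolume x :=
  Finset.prod_pos fun i _ => hx i

namespace IsFKGSystem

variable {d : ℕ} {Ω : Type*} [MeasurableSpace Ω] {X : (Fin d → ℤ) → Ω → ℝ} {P : Measure Ω}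

theorem memLp_sum (h : IsFKGSystem X P) (T : Finset (Fin d → ℤ)) :
    MemLp (fun ω => ∑ u ∈ T, X u ω) 2 P := memLp_finsetSum T fun u _ => h.memLp u

theorem memLp_boxSum (h : IsFKGSystem X P) (x : Fin d → ℕ) : MemLp (boxSum X x) 2 P :=
  h.memLp_sum _

theorem measurable_boxSum (h : IsFKGSystem X P) (x : Fin d → ℕ) : Measurable (boxSum X x) :=
  Finset.measurable_fun_sum _ fun u _ => h.meas u

theorem identDistrib_shift (h : IsFKGSystem X P) (y : Fin d → ℕ) (a : Fin d → ℤ) :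
    IdentDistrib (fun ω => ∑ u ∈ box y, X (u + a) ω) (boxSum X y) P P := by
  have hm : Measurable fun ω (u : Fin d → ℤ) => X u ω := measurable_pi_lambda _ h.meas
  have hma : Measurable fun ω (u : Fin d → ℤ) => X (u + a) ω :=
    measurable_pi_lambda _ fun u => h.meas _
  have hid : IdentDistrib (fun ω (u : Fin d → ℤ) => X (u + a) ω)
      (fun ω (u : Fin d → ℤ) => X u ω) P P := ⟨hma.aemeasurable, hm.aemeasurable, h.stationary a⟩
  exact hid.comp (u := fun z : (Fin d → ℤ) → ℝ => ∑ u ∈ box y, z u)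
    (Finset.measurable_fun_sum _ fun u _ => measurable_pi_apply u)

theorem cov_eq (h : IsFKGSystem X P) (u v : Fin d → ℤ) :
    cov[X u, X v; P] = cov[X 0, X (v - u); P] := by
  have hm : Measurable fun ω (u : Fin d → ℤ) => X u ω := measurable_pi_lambda _ h.meas
  have hma : Measurable fun ω (w : Fin d → ℤ) => X (w + u) ω :=
    measurable_pi_lambda _ fun w => h.meas _
  have h1 := covariance_map_fun (μ := P) (Z := fun ω (w : Fin d → ℤ) => X (w + u) ω)
    (X := fun z : (Fin d → ℤ) → ℝ => z 0) (Y := fun z => z (v - u))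
    (measurable_pi_apply _).aestronglyMeasurable (measurable_pi_apply _).aestronglyMeasurable
    hma.aemeasurable
  have h2 := covariance_map_fun (μ := P) (Z := fun ω (w : Fin d → ℤ) => X w ω)
    (X := fun z : (Fin d → ℤ) → ℝ => z 0) (Y := fun z => z (v - u))
    (measurable_pi_apply _).aestronglyMeasurable (measurable_pi_apply _).aestronglyMeasurable
    hm.aemeasurable
  rw [h.stationary u, h2] at h1
  simp only [zero_add, sub_add_cancel] at h1
  exact h1.symm

theorem cov_nonneg (h : IsFKGSystem X P) (u v : Fin d → ℤ) : 0 ≤ cov[X u, X v; P] :=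
  h.fkg.cov_nonneg (isIncreasing_apply u) (isIncreasing_apply v) (h.memLp u) (h.memLp v)

theorem siteVar_nonneg (x : Fin d → ℕ) : 0 ≤ siteVar X P x :=
  div_nonneg (variance_nonneg _ _) (Nat.cast_nonneg _)

variable [IsProbabilityMeasure P]

theorem integral_sum_eq_zero (h : IsFKGSystem X P) (T : Finset (Fin d → ℤ)) :
    ∫ ω, ∑ u ∈ T, X u ω ∂P = 0 := by
  rw [integral_finsetSum _ fun u _ => (h.memLp u).integrable one_le_two]
  exact Finset.sum_eq_zero fun u _ => h.mean u

theorem integral_boxSum (h : IsFKGSystem X P) (x : Fin d → ℕ) : ∫ ω, boxSum X x ω ∂P = 0 :=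
  h.integral_sum_eq_zero _

/-- Each row of the covariance matrix is, after translation, a partial sum of the nonnegative
susceptibility series. -/
theorem variance_boxSum_le (h : IsFKGSystem X P) (x : Fin d → ℕ) :
    Var[boxSum X x; P] ≤ boxVolume x * ∑' u, cov[X 0, X u; P] := by
  have hv : Var[boxSum X x; P] = ∑ u ∈ box x, ∑ v ∈ box x, cov[X u, X v; P] :=
    variance_fun_sum' fun u _ => h.memLp u
  rw [hv, ← card_box, ← nsmul_eq_mul]
  refine Finset.sum_le_card_nsmul _ _ _ fun u _ => ?_
  simp_rw [h.cov_eq u]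
  have hs : Summable fun v => cov[X 0, X (v - u); P] :=
    (Equiv.subRight u).summable_iff (f := fun v => cov[X 0, X v; P]) |>.2 h.summable
  refine (hs.sum_le_tsum _ fun v _ => h.cov_nonneg _ _).trans_eq ?_
  exact (Equiv.subRight u).tsum_eq (f := fun v => cov[X 0, X v; P])

theorem siteVar_le (h : IsFKGSystem X P) (x : Fin d → ℕ) :
    siteVar X P x ≤ ∑' u, cov[X 0, X u; P] :=
  div_le_of_le_mul₀ (Nat.cast_nonneg _) (tsum_nonneg fun _ => h.cov_nonneg _ _)
    ((h.variance_boxSum_le x).trans_eq (mul_comm _ _))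

/-- Comparison of a box with the independent union of its blocks. -/
theorem norm_charFun_boxSum_sub_pow_le (h : IsFKGSystem X P) (x y : Fin d → ℕ) (t : ℝ) :
    0 ≤ Var[boxSum X x; P] - (∏ i, x i / y i : ℕ) * Var[boxSum X y; P] ∧
    ‖charFun (P.map (boxSum X x)) t - charFun (P.map (boxSum X y)) t ^ (∏ i, x i / y i)‖ ≤
      |t| * √(Var[boxSum X x; P] - (∏ i, x i / y i : ℕ) * Var[boxSum X y; P])
        + 2 * t ^ 2 * (Var[boxSum X x; P] - (∏ i, x i / y i : ℕ) * Var[boxSum X y; P]) := by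
  classical
  set Q := blockIndex x y
  let U : (Fin d → ℕ) → Ω → ℝ := fun a ω => ∑ u ∈ box y, X (u + blockShift y a) ω
  let M : Ω → ℝ := fun ω => ∑ a ∈ Q, U a ω
  let T := (Q ×ˢ box y).image fun p : (Fin d → ℕ) × (Fin d → ℤ) => p.2 + blockShift y p.1
  let R : Ω → ℝ := fun ω => ∑ u ∈ box x \ T, X u ω
  have hT : T ⊆ box x := by
    intro w hw
    obtain ⟨p, hp, rfl⟩ := Finset.mem_image.1 hw
    rw [Finset.mem_product] at hp
    exact block_mem_box hp.1 hp.2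
  have hM : ∀ ω, M ω = ∑ u ∈ T, X u ω := fun ω => by
    rw [Finset.sum_image (block_injOn x y), Finset.sum_product]
  have hsum : boxSum X x = fun ω => M ω + R ω := funext fun ω => by
    rw [hM, add_comm]; exact (Finset.sum_sdiff hT).symm
  have hid : ∀ a, IdentDistrib (U a) (boxSum X y) P P := fun a => h.identDistrib_shift y _
  have hU2 : ∀ a, MemLp (U a) 2 P := fun a => memLp_finsetSum _ fun u _ => h.memLp _
  have hUi : ∀ a, IsIncreasing X (U a) := fun a => isIncreasing_sum _ fun u _ =>
    isIncreasing_apply _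
  have hM2 : MemLp M 2 P := memLp_finsetSum _ fun a _ => hU2 a
  have hMi : IsIncreasing X M := isIncreasing_sum _ fun a _ => hUi a
  have hR2 : MemLp R 2 P := h.memLp_sum _
  have hRi : IsIncreasing X R := isIncreasing_sum _ fun u _ => isIncreasing_apply _
  have hM0 : ∫ ω, M ω ∂P = 0 := by simp_rw [hM]; exact h.integral_sum_eq_zero _
  have hvar : Var[boxSum X x; P] = Var[M; P] + 2 * cov[M, R; P] + Var[R; P] := by
    rw [hsum, variance_fun_add hM2 hR2]
  have hcov := h.fkg.cov_nonneg hMi hRi hM2 hR2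
  have hN : ∀ t : ℝ, ‖charFun (P.map M) t - charFun (P.map (boxSum X y)) t ^ (∏ i, x i / y i)‖ ≤
      2 * t ^ 2 * (Var[M; P] - (∏ i, x i / y i : ℕ) * Var[boxSum X y; P]) := fun t => by
    have := h.fkg.norm_charFun_sum_sub_prod_le Q hUi hU2 t
    simp_rw [fun a => (hid a).map_eq, fun a => (hid a).variance_eq, Finset.prod_const,
      Finset.sum_const, nsmul_eq_mul, Q, card_blockIndex] at this
    exact this
  -- Newman's inequality at `t = 1` bounds a norm by twice this quantity.
  have hpos : 0 ≤ Var[M; P] - (∏ i, x i / y i : ℕ) * Var[boxSum X y; P] := by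
    have := (norm_nonneg _).trans (hN 1)
    linarith
  have hRv := variance_nonneg R P
  -- The variance defect is the sum of three nonnegative terms: the defect of `M` relative to its
  -- blocks, `2 * cov[M, R; P]` and `Var[R; P]`. It therefore dominates both the first and the last,
  -- which are the two errors below.
  refine ⟨by linarith, ?_⟩
  refine (norm_sub_le_norm_sub_add_norm_sub _ (charFun (P.map M) t) _).trans (add_le_add ?_ ?_)
  · refine (norm_charFun_sub_charFun_le (h.memLp_boxSum x) hM2 (h.integral_boxSum x) hM0 t t).trans ?_
    have e : (fun ω => t * boxSum X x ω - t * M ω) = fun ω => t * R ω := by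
      ext ω; rw [hsum]; ring
    rw [e, variance_const_mul, Real.sqrt_mul (sq_nonneg t), Real.sqrt_sq_eq_abs]
    gcongr
    linarith
  · refine (hN t).trans ?_
    gcongr
    linarith

end IsFKGSystem

/-! ### Newman's central limit theorem along boxes of growing volume -/

/-- The blocks fill the box asymptotically: rounding is negligible in a growing side, and absent in
a side equal to that of the block. -/
theorem tendsto_block_ratio {d : ℕ} {l : Filter (Fin d → ℕ)} {y : Fin d → ℕ} (hy : ∀ i, 0 < y i)
    (hl : ∀ i, Tendsto (fun x : Fin d → ℕ => x i) l atTop ∨ ∀ᶠ x in l, x i = y i) :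
    Tendsto (fun x : Fin d → ℕ => ((∏ i, x i / y i : ℕ) : ℝ) / boxVolume x) l
      (𝓝 (1 / boxVolume y)) := by
  have h : ∀ i ∈ Finset.univ, Tendsto (fun x : Fin d → ℕ => ((x i / y i : ℕ) : ℝ) / x i) l
      (𝓝 (1 / y i)) := by
    intro i _
    rcases hl i with h | h
    · have h1 := (tendsto_nat_floor_mul_div_atTop (R := ℝ) (a := 1 / y i) (by positivity)).comp
        (tendsto_natCast_atTop_atTop.comp h)
      refine h1.congr fun x => ?_
      simp only [Function.comp]
      rw [one_div_mul_eq_div, Nat.floor_div_natCast, Nat.floor_natCast]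
    · refine tendsto_const_nhds.congr' ?_
      filter_upwards [h] with x hx
      rw [hx, Nat.div_self (hy i), Nat.cast_one]
  have h2 := tendsto_finsetProd Finset.univ h
  simp only [boxVolume]
  push_cast
  simpa [Finset.prod_div_distrib] using h2

/-- Along an ultrafilter, a sequence of naturals is eventually constant or tends to infinity. -/
theorem ultrafilter_nat_dichotomy {α : Type*} (U : Ultrafilter α) (f : α → ℕ) :
    Tendsto f U atTop ∨ ∃ c, ∀ᶠ x in U, f x = c := by
  rcases (U.map f).le_cofinite_or_eq_pure with h | ⟨c, h⟩
  · left
    rw [← Nat.cofinite_eq_atTop]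
    exact h
  · right
    refine ⟨c, ?_⟩
    have : {c} ∈ U.map f := by rw [h]; exact Set.mem_singleton c
    exact this

/-- The boxes of large volume. -/
def largeBoxes (d : ℕ) : Filter (Fin d → ℕ) := comap boxVolume atTop

theorem eventually_pos_largeBoxes (d : ℕ) : ∀ᶠ x in largeBoxes d, ∀ i, 0 < x i := by
  have h : ∀ᶠ x in largeBoxes d, 0 < boxVolume x := tendsto_comap.eventually_gt_atTop 0
  filter_upwards [h] with x hx i
  exact Nat.pos_of_ne_zero fun h0 => hx.ne' (Finset.prod_eq_zero (Finset.mem_univ i) h0)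

theorem tendsto_boxVolume_largeBoxes (d : ℕ) :
    Tendsto (fun x : Fin d → ℕ => (boxVolume x : ℝ)) (largeBoxes d) atTop :=
  tendsto_natCast_atTop_atTop.comp tendsto_comap

namespace IsFKGSystem

variable {d : ℕ} {Ω : Type*} [MeasurableSpace Ω] {X : (Fin d → ℤ) → Ω → ℝ} {P : Measure Ω}
  [IsProbabilityMeasure P]

/-- Compactness replaces convergence of the variance per site, which can have different limits when
some sides stay bounded. -/
theorem exists_tendsto_siteVar (h : IsFKGSystem X P) (U : Ultrafilter (Fin d → ℕ)) :
    ∃ s : ℝ, 0 ≤ s ∧ Tendsto (siteVar X P) U (𝓝 s) := by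
  have hc : IsCompact (Set.Icc (0 : ℝ) (∑' u, cov[X 0, X u; P])) := isCompact_Icc
  have hmem : ∀ᶠ x in (U : Filter (Fin d → ℕ)),
      siteVar X P x ∈ Set.Icc (0 : ℝ) (∑' u, cov[X 0, X u; P]) :=
    Eventually.of_forall fun x => ⟨siteVar_nonneg x, h.siteVar_le x⟩
  obtain ⟨s, hs, hle⟩ := hc.ultrafilter_le_nhds (U.map (siteVar X P)) (le_principal_iff.2 hmem)
  exact ⟨s, hs.1, hle⟩

/-- The powers arising from a fixed block converge by the classical central limit theorem. -/
theorem tendsto_charFun_block_pow (h : IsFKGSystem X P) {l : Filter (Fin d → ℕ)}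
    (hl : l ≤ largeBoxes d) {y : Fin d → ℕ} (hy : ∀ i, 0 < y i)
    (hly : ∀ i, Tendsto (fun x : Fin d → ℕ => x i) l atTop ∨ ∀ᶠ x in l, x i = y i) (t : ℝ) :
    Tendsto (fun x => charFun (P.map (boxSum X y)) (t / √(boxVolume x)) ^ (∏ i, x i / y i)) l
      (𝓝 (Complex.exp (-(t ^ 2 * siteVar X P y / 2 : ℝ)))) := by
  have hp : IsProbabilityMeasure (P.map (boxSum X y)) :=
    Measure.isProbabilityMeasure_map (h.measurable_boxSum y).aemeasurable
  have hvol : Tendsto (fun x : Fin d → ℕ => (boxVolume x : ℝ)) l atTop :=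
    (tendsto_boxVolume_largeBoxes d).mono_left hl
  have hr := tendsto_block_ratio hy hly
  set v := Var[boxSum X y; P] with hv
  have hv0 : 0 ≤ v := variance_nonneg _ _
  have hu : Tendsto (fun x : Fin d → ℕ => t / √(boxVolume x)) l (𝓝 0) :=
    tendsto_const_nhds.div_atTop (Real.tendsto_sqrt_atTop.comp hvol)
  have hlo := (charFun_map_sub_exp_isLittleO (h.memLp_boxSum y) (h.integral_boxSum y)).comp_tendsto hu
  -- the Gaussian powers
  have hG : Tendsto (fun x : Fin d → ℕ =>
      Complex.exp (-(v * (t / √(boxVolume x)) ^ 2 / 2 : ℝ)) ^ (∏ i, x i / y i)) l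
      (𝓝 (Complex.exp (-(t ^ 2 * siteVar X P y / 2 : ℝ)))) := by
    have h1 : Tendsto (fun x : Fin d → ℕ =>
        -(t ^ 2 * v / 2 * (((∏ i, x i / y i : ℕ) : ℝ) / boxVolume x))) l
        (𝓝 (-(t ^ 2 * siteVar X P y / 2))) := by
      have e : -(t ^ 2 * siteVar X P y / 2) = -(t ^ 2 * v / 2 * (1 / boxVolume y)) := by
        rw [siteVar, hv]; ring
      rw [e]
      exact (hr.const_mul _).neg
    have h2 := (Complex.continuous_exp.comp Complex.continuous_ofReal).continuousAt.tendsto.comp h1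
    simp only [Function.comp_def] at h2
    rw [← Complex.ofReal_neg]
    refine h2.congr fun x => ?_
    rw [← Complex.exp_nat_mul]
    congr 1
    rw [div_pow, Real.sq_sqrt (Nat.cast_nonneg _)]
    push_cast
    ring
  have hdiff : Tendsto (fun x : Fin d → ℕ =>
      charFun (P.map (boxSum X y)) (t / √(boxVolume x)) ^ (∏ i, x i / y i)
        - Complex.exp (-(v * (t / √(boxVolume x)) ^ 2 / 2 : ℝ)) ^ (∏ i, x i / y i)) l (𝓝 0) := by
    -- Comparing powers costs a factor equal to the number of blocks, which is of order `boxVolume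
    -- x`; the second-order agreement at `0` gives an error `o(1 / boxVolume x)` for each factor.
    have hb : (fun x : Fin d → ℕ => (((∏ i, x i / y i : ℕ) : ℝ) / boxVolume x) *
        ((boxVolume x : ℝ) * ‖charFun (P.map (boxSum X y)) (t / √(boxVolume x))
          - Complex.exp (-(v * (t / √(boxVolume x)) ^ 2 / 2 : ℝ))‖)) =o[l] fun _ => (1 : ℝ) := by
      have h1 := (Asymptotics.isBigO_refl (fun x : Fin d → ℕ => (boxVolume x : ℝ)) l).mul_isLittleO
        hlo.norm_left
      have h2 : (fun x : Fin d → ℕ => (boxVolume x : ℝ) *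
          ((fun u : ℝ => u ^ 2) ∘ fun x : Fin d → ℕ => t / √(boxVolume x)) x) =O[l]
          fun _ => (1 : ℝ) := by
        refine Asymptotics.IsBigO.of_bound (t ^ 2) (Eventually.of_forall fun x => ?_)
        simp only [Function.comp_def]
        rw [div_pow, Real.sq_sqrt (Nat.cast_nonneg _), norm_one, mul_one]
        rcases eq_or_ne (boxVolume x : ℝ) 0 with h0 | h0
        · rw [h0]; simp; positivity
        · rw [mul_div_cancel₀ _ h0, Real.norm_of_nonneg (sq_nonneg t)]
      simpa using hr.isBigO_one ℝ |>.mul_isLittleO (h1.trans_isBigO h2)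
    refine squeeze_zero_norm' ?_ ((Asymptotics.isLittleO_one_iff ℝ).1 hb)
    filter_upwards [hl (eventually_pos_largeBoxes d)] with x hx
    refine (norm_pow_sub_pow_le (norm_charFun_le_one _) ?_ _).trans_eq ?_
    · rw [← Complex.ofReal_neg, ← Complex.ofReal_exp, Complex.norm_real, Real.norm_eq_abs,
        Real.abs_exp, Real.exp_le_one_iff]
      have : 0 ≤ v * (t / √(boxVolume x)) ^ 2 / 2 := by positivity
      linarith
    · have h0 : (boxVolume x : ℝ) ≠ 0 := by
        exact_mod_cast (boxVolume_pos hx).ne'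
      field_simp
  simpa using hdiff.add hG

/-- **Newman's central limit theorem** along an ultrafilter of boxes of growing volume. -/
theorem tendsto_charFun_boxSum (h : IsFKGSystem X P) {U : Ultrafilter (Fin d → ℕ)}
    (hU : (U : Filter _) ≤ largeBoxes d) {s : ℝ} (hs : Tendsto (siteVar X P) U (𝓝 s)) (t : ℝ) :
    Tendsto (fun x => charFun (P.map (boxSum X x)) (t / √(boxVolume x))) U
      (𝓝 (Complex.exp (-(t ^ 2 * s / 2 : ℝ)))) := by
  -- `F r` is the limiting total error when the reference block has variance `r` per site:
  -- remainder, dependence between blocks, and the discrepancy between the two Gaussian limits.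
  let F : ℝ → ℝ := fun r => |t| * √(s - r) + 2 * t ^ 2 * (s - r)
    + ‖Complex.exp (-(t ^ 2 * r / 2 : ℝ)) - Complex.exp (-(t ^ 2 * s / 2 : ℝ))‖
  have hF : Continuous F := by fun_prop
  have hFs : F s = 0 := by simp [F]
  rw [Metric.tendsto_nhds]
  intro ε hε
  -- a typical block
  have hy1 : ∀ᶠ y in (U : Filter (Fin d → ℕ)), F (siteVar X P y) < ε := by
    have := (hF.tendsto s).comp hs
    rw [hFs] at this
    exact this.eventually_lt_const hε
  -- The block is drawn from the ultrafilter itself, so its sides agree with every side that is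
  -- eventually constant.
  have hy2 : ∀ᶠ y in (U : Filter (Fin d → ℕ)), ∀ i,
      Tendsto (fun x : Fin d → ℕ => x i) U atTop ∨
      ∀ᶠ x in (U : Filter (Fin d → ℕ)), x i = y i := by
    refine eventually_all.2 fun i => ?_
    rcases ultrafilter_nat_dichotomy U (fun x => x i) with h1 | ⟨c, hc⟩
    · exact Eventually.of_forall fun _ => Or.inl h1
    · filter_upwards [hc] with y hy
      right
      rw [hy]
      exact hc
  obtain ⟨y, hyF, hyU, hy⟩ := (hy1.and (hy2.and (hU (eventually_pos_largeBoxes d)))).exists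
  have hr := tendsto_block_ratio hy hyU
  set D : (Fin d → ℕ) → ℝ := fun x =>
    siteVar X P x - (((∏ i, x i / y i : ℕ) : ℝ) / boxVolume x) * Var[boxSum X y; P] with hD
  have hDlim : Tendsto D U (𝓝 (s - siteVar X P y)) := by
    have e : siteVar X P y = 1 / boxVolume y * Var[boxSum X y; P] := by rw [siteVar]; ring
    rw [e]
    exact hs.sub (hr.mul_const _)
  have hpow := h.tendsto_charFun_block_pow hU hy hyU t
  have hlim : Tendsto (fun x => |t| * √(D x) + 2 * t ^ 2 * D x +
      ‖charFun (P.map (boxSum X y)) (t / √(boxVolume x)) ^ (∏ i, x i / y i)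
        - Complex.exp (-(t ^ 2 * s / 2 : ℝ))‖) U (𝓝 (F (siteVar X P y))) :=
    ((((Real.continuous_sqrt.tendsto _).comp hDlim).const_mul _).add (hDlim.const_mul _)).add
      (hpow.sub_const _).norm
  filter_upwards [hlim.eventually_lt_const hyF, hU (eventually_pos_largeBoxes d)] with x hx hxpos
  rw [dist_eq_norm]
  refine lt_of_le_of_lt ?_ hx
  refine (norm_sub_le_norm_sub_add_norm_sub _
    (charFun (P.map (boxSum X y)) (t / √(boxVolume x)) ^ (∏ i, x i / y i)) _).trans ?_
  gcongr
  obtain ⟨h1, h2⟩ := h.norm_charFun_boxSum_sub_pow_le x y (t / √(boxVolume x))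
  have hV : (0 : ℝ) < boxVolume x := by exact_mod_cast boxVolume_pos hxpos
  have hDx : D x = (Var[boxSum X x; P] - (∏ i, x i / y i : ℕ) * Var[boxSum X y; P])
      / boxVolume x := by
    simp only [hD, siteVar]; ring
  refine h2.trans_eq ?_
  -- The scaling of `t` by `1 / √(boxVolume x)` turns the variance defect into the defect per site
  -- `D x`.
  rw [hDx, Real.sqrt_div h1, abs_div, abs_of_nonneg (Real.sqrt_nonneg _), div_pow,
    Real.sq_sqrt hV.le]
  ring

/-- The central limit theorem with a converging argument of the characteristic function. -/
theorem tendsto_charFun_boxSum_of_tendsto (h : IsFKGSystem X P) {U : Ultrafilter (Fin d → ℕ)}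
    (hU : (U : Filter _) ≤ largeBoxes d) {s : ℝ} (hs : Tendsto (siteVar X P) U (𝓝 s))
    {θ : (Fin d → ℕ) → ℝ} {t : ℝ} (hθ : Tendsto θ U (𝓝 t)) :
    Tendsto (fun x => charFun (P.map (boxSum X x)) (θ x / √(boxVolume x))) U
      (𝓝 (Complex.exp (-(t ^ 2 * s / 2 : ℝ)))) := by
  have h1 := h.tendsto_charFun_boxSum hU hs t
  have h2 : Tendsto (fun x => charFun (P.map (boxSum X x)) (θ x / √(boxVolume x))
      - charFun (P.map (boxSum X x)) (t / √(boxVolume x))) U (𝓝 0) := by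
    have h3 : Tendsto (fun x => |θ x - t| * √(siteVar X P x)) U (𝓝 0) := by
      have := (hθ.sub_const t).abs.mul ((Real.continuous_sqrt.tendsto _).comp hs)
      simpa using this
    refine squeeze_zero_norm (fun x => ?_) h3
    refine (norm_charFun_sub_charFun_le (h.memLp_boxSum x) (h.memLp_boxSum x) (h.integral_boxSum x)
      (h.integral_boxSum x) _ _).trans_eq ?_
    have e : (fun ω => θ x / √(boxVolume x) * boxSum X x ω - t / √(boxVolume x) * boxSum X x ω) =
        fun ω => ((θ x - t) / √(boxVolume x)) * boxSum X x ω := by ext ω; ring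
    rw [e, variance_const_mul, siteVar, div_pow, Real.sq_sqrt (Nat.cast_nonneg _),
      div_mul_eq_mul_div, mul_div_assoc, Real.sqrt_mul (sq_nonneg _), Real.sqrt_sq_eq_abs]
  simpa using h2.add h1

end IsFKGSystem

/-! ### Fisher information of Gaussian mixtures -/

theorem IsSmoothDensity.unique {f g : ℝ → ℝ} {μ : Measure ℝ} [IsProbabilityMeasure μ]
    (hf : IsSmoothDensity f μ) (hg : IsSmoothDensity g μ) : f = g := by
  have mf := hf.contDiff.continuous.measurable
  have mg := hg.contDiff.continuous.measurable
  have h1 : ∫⁻ x, ENNReal.ofReal (f x) ≠ ∞ := by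
    have : μ Set.univ = ∫⁻ x, ENNReal.ofReal (f x) := by
      rw [hf.eq_withDensity, withDensity_apply _ MeasurableSet.univ, Measure.restrict_univ]
    rw [← this]
    exact measure_ne_top _ _
  have h2 := (withDensity_eq_iff (μ := volume) mf.ennreal_ofReal.aemeasurable
    mg.ennreal_ofReal.aemeasurable h1).1 (hf.eq_withDensity.symm.trans hg.eq_withDensity)
  refine (hf.contDiff.continuous.ae_eq_iff_eq volume hg.contDiff.continuous).1 ?_
  filter_upwards [h2] with x hx
  exact (ENNReal.ofReal_eq_ofReal_iff (hf.nonneg x) (hg.nonneg x)).1 hx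

theorem fisherInfo_eq_lintegral {Ω : Type*} [MeasurableSpace Ω] {P : Measure Ω}
    [IsProbabilityMeasure P] {U : Ω → ℝ} (hU : Measurable U) {f : ℝ → ℝ}
    (hf : IsSmoothDensity f (P.map U)) (hpos : ∀ x, 0 < f x) :
    fisherInfo U P = ∫⁻ v, ENNReal.ofReal (deriv f v ^ 2 / f v) := by
  have : IsProbabilityMeasure (P.map U) := Measure.isProbabilityMeasure_map hU.aemeasurable
  have hfm := hf.contDiff.continuous.measurable
  have hdm : Measurable (deriv f) := measurable_deriv f
  have hsm : Measurable fun v => ENNReal.ofReal (score f v ^ 2) :=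
    ((hdm.div hfm).pow_const 2).ennreal_ofReal
  have h1 : fisherInfo U P = ∫⁻ ω, ENNReal.ofReal (score f (U ω) ^ 2) ∂P := by
    refine le_antisymm (iInf₂_le f hf) (le_iInf₂ fun g hg => ?_)
    rw [hg.unique hf]
  rw [h1, ← lintegral_map (f := fun v => ENNReal.ofReal (score f v ^ 2)) hsm hU,
    hf.eq_withDensity, lintegral_withDensity_eq_lintegral_mul _ hfm.ennreal_ofReal hsm]
  refine lintegral_congr fun v => ?_
  rw [Pi.mul_apply, ← ENNReal.ofReal_mul (hpos v).le]
  congr 1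
  have := (hpos v).ne'
  simp only [score]
  field_simp

/-- A generalised dominated convergence theorem. -/
theorem tendsto_lintegral_of_le_of_tendsto {α : Type*} [MeasurableSpace α] {μ : Measure α}
    {h g : ℕ → α → ℝ≥0∞} {h' g' : α → ℝ≥0∞} {c : ℝ≥0∞} (hc : c ≠ ∞)
    (hm : ∀ n, Measurable (h n)) (gm : ∀ n, Measurable (g n)) (hm' : Measurable h')
    (hle : ∀ n x, h n x ≤ g n x) (hle' : ∀ x, h' x ≤ g' x) (gtop : ∀ x, g' x ≠ ∞)
    (hlim : ∀ x, Tendsto (fun n => h n x) atTop (𝓝 (h' x)))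
    (glim : ∀ x, Tendsto (fun n => g n x) atTop (𝓝 (g' x)))
    (gint : ∀ n, ∫⁻ x, g n x ∂μ = c) (gint' : ∫⁻ x, g' x ∂μ = c) :
    Tendsto (fun n => ∫⁻ x, h n x ∂μ) atTop (𝓝 (∫⁻ x, h' x ∂μ)) := by
  have fin : ∀ n, ∫⁻ x, h n x ∂μ ≠ ∞ := fun n =>
    ne_top_of_le_ne_top hc ((lintegral_mono (hle n)).trans_eq (gint n))
  have fin' : ∫⁻ x, h' x ∂μ ≠ ∞ := ne_top_of_le_ne_top hc ((lintegral_mono hle').trans_eq gint')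
  refine tendsto_of_le_liminf_of_limsup_le ?_ ?_
  · refine le_trans (le_of_eq ?_) (lintegral_liminf_le hm)
    exact lintegral_congr fun x => (hlim x).liminf_eq.symm
  -- Fatou's lemma for `g n - h n` yields the upper bound, because the common finite mass `c`
  -- cancels.
  · have h1 : ∫⁻ x, (g' x - h' x) ∂μ ≤ liminf (fun n => ∫⁻ x, (g n x - h n x) ∂μ) atTop := by
      refine le_trans (le_of_eq ?_) (lintegral_liminf_le fun n => (gm n).sub (hm n))
      exact lintegral_congr fun x =>
        (ENNReal.Tendsto.sub (glim x) (hlim x) (Or.inl (gtop x))).liminf_eq.symm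
    rw [lintegral_sub hm' fin' (ae_of_all _ hle'), gint'] at h1
    simp_rw [fun n => lintegral_sub (hm n) (fin n) (ae_of_all μ (hle n)), gint] at h1
    rw [ENNReal.liminf_const_sub _ _ hc] at h1
    have h2 : limsup (fun n => ∫⁻ x, h n x ∂μ) atTop ≤ c :=
      limsup_le_of_le (by isBoundedDefault)
        (Eventually.of_forall fun n => (lintegral_mono (hle n)).trans_eq (gint n))
    have h3 : ∫⁻ x, h' x ∂μ ≤ c := (lintegral_mono hle').trans_eq gint'
    exact (ENNReal.sub_le_sub_iff_left h2 hc).1 h1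

/-! ### Gaussian kernels and their mixtures -/

section Kernels

variable {τ : ℝ≥0}

/-- The derivative of the centred Gaussian density. -/
noncomputable def gaussianDeriv (τ : ℝ≥0) (z : ℝ) : ℝ := -(z / τ) * gaussianPDFReal 0 τ z

/-- The centred Gaussian density weighted by the square of its score. -/
noncomputable def gaussianSqScore (τ : ℝ≥0) (z : ℝ) : ℝ := (z / τ) ^ 2 * gaussianPDFReal 0 τ z

theorem continuous_gaussianPDFReal (m : ℝ) (τ : ℝ≥0) : Continuous (gaussianPDFReal m τ) := by
  rw [gaussianPDFReal_def]
  fun_prop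

theorem continuous_gaussianDeriv (τ : ℝ≥0) : Continuous (gaussianDeriv τ) := by
  have := continuous_gaussianPDFReal 0 τ
  unfold gaussianDeriv
  fun_prop

theorem continuous_gaussianSqScore (τ : ℝ≥0) : Continuous (gaussianSqScore τ) := by
  have := continuous_gaussianPDFReal 0 τ
  unfold gaussianSqScore
  fun_prop

theorem gaussianSqScore_nonneg (τ : ℝ≥0) (z : ℝ) : 0 ≤ gaussianSqScore τ z :=
  mul_nonneg (sq_nonneg _) (gaussianPDFReal_nonneg _ _ _)

theorem hasDerivAt_gaussianPDFReal (τ : ℝ≥0) (z : ℝ) :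
    HasDerivAt (gaussianPDFReal 0 τ) (gaussianDeriv τ z) z := by
  have h1 : HasDerivAt (fun z : ℝ => -(z - 0) ^ 2 / (2 * τ)) (-(z / τ)) z := by
    have h := (((hasDerivAt_id' z).sub_const 0).fun_pow 2).fun_neg.div_const (2 * (τ : ℝ))
    refine h.congr_deriv ?_
    rw [Nat.cast_ofNat, sub_zero, mul_one, pow_one, neg_div, mul_div_mul_left _ _ two_ne_zero]
  refine ((h1.exp).const_mul (√(2 * Real.pi * τ))⁻¹).congr_deriv ?_
  rw [gaussianDeriv, gaussianPDFReal]
  ring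

theorem gaussianPDFReal_le (τ : ℝ≥0) (z : ℝ) :
    gaussianPDFReal 0 τ z ≤ (√(2 * Real.pi * τ))⁻¹ := by
  rw [gaussianPDFReal]
  refine mul_le_of_le_one_right (by positivity) ?_
  rw [Real.exp_le_one_iff, neg_div]
  exact neg_nonpos.2 (by positivity)

theorem gaussianSqScore_le (hτ : τ ≠ 0) (z : ℝ) :
    gaussianSqScore τ z ≤ 2 / τ * (√(2 * Real.pi * τ))⁻¹ := by
  have hτ' : (0 : ℝ) < τ := by positivity
  -- With `w = z ^ 2 / (2 * τ)`, the bound is `w * exp (-w) ≤ 1`.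
  have e : gaussianSqScore τ z = 2 / τ * (√(2 * Real.pi * τ))⁻¹ *
      (z ^ 2 / (2 * τ) * Real.exp (-(z ^ 2 / (2 * τ)))) := by
    rw [gaussianSqScore, gaussianPDFReal, sub_zero, neg_div]
    field_simp
  rw [e]
  refine mul_le_of_le_one_right (by positivity) ?_
  have := Real.add_one_le_exp (z ^ 2 / (2 * τ))
  rw [Real.exp_neg, ← div_eq_mul_inv, div_le_one (Real.exp_pos _)]
  linarith

/-- A common bound for the Gaussian density and its weighted versions. -/
noncomputable def gaussianBound (τ : ℝ≥0) : ℝ := (1 + 2 / τ) * (√(2 * Real.pi * τ))⁻¹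

theorem abs_gaussianPDFReal_le (τ : ℝ≥0) (z : ℝ) : |gaussianPDFReal 0 τ z| ≤ gaussianBound τ := by
  rw [abs_of_nonneg (gaussianPDFReal_nonneg _ _ _)]
  refine (gaussianPDFReal_le τ z).trans (le_mul_of_one_le_left (by positivity) ?_)
  have : (0 : ℝ) ≤ 2 / τ := by positivity
  linarith

theorem abs_gaussianSqScore_le (hτ : τ ≠ 0) (z : ℝ) : |gaussianSqScore τ z| ≤ gaussianBound τ := by
  rw [abs_of_nonneg (gaussianSqScore_nonneg _ _)]
  refine (gaussianSqScore_le hτ z).trans ?_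
  unfold gaussianBound
  gcongr
  linarith

theorem abs_gaussianDeriv_le (hτ : τ ≠ 0) (z : ℝ) : |gaussianDeriv τ z| ≤ gaussianBound τ := by
  have h1 := gaussianPDFReal_le τ z
  have h2 := gaussianSqScore_le hτ z
  have h0 := gaussianPDFReal_nonneg 0 τ z
  have h3 : |gaussianDeriv τ z| ≤ gaussianPDFReal 0 τ z + gaussianSqScore τ z := by
    rw [gaussianDeriv, gaussianSqScore, abs_mul, abs_of_nonneg h0, abs_neg, ← sq_abs (z / τ)]
    nlinarith [sq_nonneg (|z / (τ : ℝ)| - 1), abs_nonneg (z / (τ : ℝ))]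
  unfold gaussianBound
  linarith

theorem lintegral_gaussianSqScore (hτ : τ ≠ 0) :
    ∫⁻ z, ENNReal.ofReal (gaussianSqScore τ z) = ENNReal.ofReal (τ : ℝ)⁻¹ := by
  have hτ' : (τ : ℝ) ≠ 0 := by exact_mod_cast hτ
  have h1 : ∫⁻ z, ENNReal.ofReal ((z / τ) ^ 2) ∂gaussianReal 0 τ = ENNReal.ofReal (τ : ℝ)⁻¹ := by
    have hint : Integrable (fun z : ℝ => (z / τ) ^ 2) (gaussianReal 0 τ) := by
      have := (memLp_id_gaussianReal' (μ := 0) (v := τ) 2 (by simp)).integrable_sq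
      simpa [div_pow] using this.div_const ((τ : ℝ) ^ 2)
    rw [← ofReal_integral_eq_lintegral_ofReal hint (ae_of_all _ fun z => sq_nonneg _)]
    congr 1
    have hv := variance_of_integral_eq_zero (μ := gaussianReal 0 τ) (X := fun x => x)
      (by fun_prop) integral_id_gaussianReal
    rw [variance_fun_id_gaussianReal] at hv
    simp_rw [div_pow]
    rw [integral_div, ← hv]
    field_simp
  rw [← h1, gaussianReal_of_var_ne_zero 0 hτ, lintegral_withDensity_eq_lintegral_mul _
    (measurable_gaussianPDF 0 τ) (by fun_prop)]
  refine lintegral_congr fun z => ?_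
  rw [Pi.mul_apply, gaussianPDF, ← ENNReal.ofReal_mul (gaussianPDFReal_nonneg _ _ _),
    gaussianSqScore, mul_comm]

/-- The mixture of the translates of a kernel `k` under a law `μ`. -/
noncomputable def mixture (k : ℝ → ℝ) (μ : Measure ℝ) (v : ℝ) : ℝ := ∫ y, k (v - y) ∂μ

variable {μ : Measure ℝ} [IsProbabilityMeasure μ] {k : ℝ → ℝ} {C : ℝ}

theorem integrable_kernel (hk : Continuous k) (hC : ∀ z, |k z| ≤ C) (v : ℝ) :
    Integrable (fun y => k (v - y)) μ :=
  Integrable.of_bound (C := C) (by fun_prop) (ae_of_all _ fun _ => hC _)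

theorem continuous_mixture (hk : Continuous k) (hC : ∀ z, |k z| ≤ C) :
    Continuous (mixture k μ) :=
  continuous_of_dominated (bound := fun _ => C) (fun v => by fun_prop)
    (fun v => ae_of_all _ fun y => hC _) (integrable_const _) (ae_of_all _ fun y => by fun_prop)

/-- By Tonelli and translation invariance the mass does not depend on `μ`. This makes the dominating
functions for the Fisher information have equal integrals. -/
theorem lintegral_mixture (hk : Continuous k) (hC : ∀ z, |k z| ≤ C) (h0 : ∀ z, 0 ≤ k z) :
    ∫⁻ v, ENNReal.ofReal (mixture k μ v) = ∫⁻ z, ENNReal.ofReal (k z) := by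
  simp_rw [mixture, fun v => ofReal_integral_eq_lintegral_ofReal (μ := μ)
    (integrable_kernel hk hC v) (ae_of_all _ fun y => h0 (v - y))]
  rw [lintegral_lintegral_swap (by fun_prop)]
  have e : ∀ y, ∫⁻ v, ENNReal.ofReal (k (v - y)) = ∫⁻ z, ENNReal.ofReal (k z) := fun y =>
    lintegral_sub_right_eq_self (fun z => ENNReal.ofReal (k z)) y
  simp [e]

theorem hasDerivAt_mixture_gaussian (hτ : τ ≠ 0) (v : ℝ) :
    HasDerivAt (mixture (gaussianPDFReal 0 τ) μ) (mixture (gaussianDeriv τ) μ v) v := by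
  have c0 := continuous_gaussianPDFReal 0 τ
  have c1 := continuous_gaussianDeriv τ
  refine (hasDerivAt_integral_of_dominated_loc_of_deriv_le (μ := μ) (s := Set.univ)
    (F := fun v y => gaussianPDFReal 0 τ (v - y)) (F' := fun v y => gaussianDeriv τ (v - y))
    (bound := fun _ => gaussianBound τ) univ_mem
    (Eventually.of_forall fun x => by fun_prop)
    (integrable_kernel c0 (abs_gaussianPDFReal_le τ) v) (by fun_prop)
    (ae_of_all _ fun y x _ => abs_gaussianDeriv_le hτ _) (integrable_const _)
    (ae_of_all _ fun y x _ => ?_)).2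
  exact (hasDerivAt_gaussianPDFReal τ (x - y)).comp_sub_const x y

theorem deriv_mixture_gaussian (hτ : τ ≠ 0) :
    deriv (mixture (gaussianPDFReal 0 τ) μ) = mixture (gaussianDeriv τ) μ :=
  funext fun v => (hasDerivAt_mixture_gaussian hτ v).deriv

theorem mixture_gaussian_pos (hτ : τ ≠ 0) (v : ℝ) : 0 < mixture (gaussianPDFReal 0 τ) μ v := by
  have hi := integrable_kernel (μ := μ) (continuous_gaussianPDFReal 0 τ)
    (abs_gaussianPDFReal_le τ) v
  refine (integral_pos_iff_support_of_nonneg (fun y => gaussianPDFReal_nonneg _ _ _) hi).2 ?_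
  have : Function.support (fun y => gaussianPDFReal 0 τ (v - y)) = Set.univ :=
    Set.eq_univ_of_forall fun y => (gaussianPDFReal_pos 0 τ _ hτ).ne'
  rw [this]
  simp

theorem isSmoothDensity_mixture_gaussian (hτ : τ ≠ 0) :
    IsSmoothDensity (mixture (gaussianPDFReal 0 τ) μ) (μ ∗ gaussianReal 0 τ) where
  contDiff := by
    refine contDiff_one_iff_deriv.2
      ⟨fun v => (hasDerivAt_mixture_gaussian hτ v).differentiableAt, ?_⟩
    rw [deriv_mixture_gaussian hτ]
    exact continuous_mixture (continuous_gaussianDeriv τ) (abs_gaussianDeriv_le hτ)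
  nonneg v := (mixture_gaussian_pos hτ v).le
  eq_withDensity := by
    have c0 := continuous_gaussianPDFReal 0 τ
    ext s hs
    rw [withDensity_apply _ hs]
    simp_rw [mixture, fun v => ofReal_integral_eq_lintegral_ofReal (μ := μ)
      (integrable_kernel c0 (abs_gaussianPDFReal_le τ) v)
      (ae_of_all _ fun y => gaussianPDFReal_nonneg 0 τ (v - y))]
    rw [lintegral_lintegral_swap (by fun_prop), ← lintegral_indicator_one hs,
      Measure.lintegral_conv (measurable_one.indicator hs)]
    refine lintegral_congr fun y => ?_
    have e : ∫⁻ z, s.indicator 1 (y + z) ∂gaussianReal 0 τ = gaussianReal y τ s := by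
      have := gaussianReal_map_const_add (μ := 0) (v := τ) y
      rw [zero_add] at this
      rw [← this, ← lintegral_indicator_one hs,
        lintegral_map (measurable_one.indicator hs) (by fun_prop)]
    rw [e, gaussianReal_apply y hτ]
    refine lintegral_congr fun v => ?_
    rw [gaussianPDFReal_sub, zero_add, gaussianPDF]

/-- The Cauchy–Schwarz bound for the Fisher information density of a Gaussian mixture. -/
theorem sq_mixture_div_le (hτ : τ ≠ 0) (v : ℝ) :
    mixture (gaussianDeriv τ) μ v ^ 2 / mixture (gaussianPDFReal 0 τ) μ v ≤
      mixture (gaussianSqScore τ) μ v := by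
  have i0 := integrable_kernel (μ := μ) (continuous_gaussianPDFReal 0 τ)
    (abs_gaussianPDFReal_le τ) v
  have i1 := integrable_kernel (μ := μ) (continuous_gaussianDeriv τ) (abs_gaussianDeriv_le hτ) v
  have i2 := integrable_kernel (μ := μ) (continuous_gaussianSqScore τ)
    (abs_gaussianSqScore_le hτ) v
  have hpos := mixture_gaussian_pos (μ := μ) hτ v
  set f := mixture (gaussianPDFReal 0 τ) μ v with hf
  set f' := mixture (gaussianDeriv τ) μ v with hf'
  -- The integrand is `((v - y) / τ + f' / f) ^ 2` times the Gaussian density; its integral is the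
  -- gap in the Cauchy–Schwarz inequality.
  have h : 0 ≤ ∫ y, (gaussianSqScore τ (v - y) - 2 * (f' / f) * gaussianDeriv τ (v - y)
      + (f' / f) ^ 2 * gaussianPDFReal 0 τ (v - y)) ∂μ := by
    refine integral_nonneg fun y => ?_
    have e : gaussianSqScore τ (v - y) - 2 * (f' / f) * gaussianDeriv τ (v - y)
      + (f' / f) ^ 2 * gaussianPDFReal 0 τ (v - y) =
      ((v - y) / τ + f' / f) ^ 2 * gaussianPDFReal 0 τ (v - y) := by
      simp only [gaussianSqScore, gaussianDeriv]; ring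
    simp only [Pi.zero_apply]
    rw [e]
    exact mul_nonneg (sq_nonneg _) (gaussianPDFReal_nonneg _ _ _)
  have i21 : Integrable (fun y => gaussianSqScore τ (v - y)
      - 2 * (f' / f) * gaussianDeriv τ (v - y)) μ := i2.sub (i1.const_mul _)
  rw [integral_add i21 (i0.const_mul _), integral_sub i2 (i1.const_mul _), integral_const_mul, integral_const_mul] at h
  change 0 ≤ mixture (gaussianSqScore τ) μ v - 2 * (f' / f) * f' + (f' / f) ^ 2 * f at h
  have e : mixture (gaussianSqScore τ) μ v - 2 * (f' / f) * f' + (f' / f) ^ 2 * f =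
      mixture (gaussianSqScore τ) μ v - f' ^ 2 / f := by
    field_simp
    ring
  rw [e] at h
  linarith

theorem tendsto_mixture {μs : ℕ → ProbabilityMeasure ℝ} {μ' : ProbabilityMeasure ℝ}
    (h : Tendsto μs atTop (𝓝 μ')) (hk : Continuous k) (hC : ∀ z, |k z| ≤ C) (v : ℝ) :
    Tendsto (fun n => mixture k (μs n : Measure ℝ) v) atTop (𝓝 (mixture k (μ' : Measure ℝ) v)) :=
  ProbabilityMeasure.tendsto_iff_forall_integral_tendsto.1 h
    (BoundedContinuousFunction.ofNormedAddCommGroup (fun y => k (v - y)) (by fun_prop) C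
      fun _ => hC _)

/-- Both sides are smooth densities of the same convolution, so uniqueness avoids computing the
integral and covers `s = 0`. -/
theorem mixture_gaussian_gaussianReal (hτ : τ ≠ 0) (s : ℝ≥0) :
    mixture (gaussianPDFReal 0 τ) (gaussianReal 0 s) = gaussianPDFReal 0 (s + τ) := by
  have hsτ : s + τ ≠ 0 := by
    intro h0; exact hτ (add_eq_zero.1 h0).2
  refine (isSmoothDensity_mixture_gaussian hτ).unique ⟨?_, gaussianPDFReal_nonneg _ _, ?_⟩
  · rw [gaussianPDFReal_def]; fun_prop
  · rw [gaussianReal_conv_gaussianReal, zero_add, gaussianReal_of_var_ne_zero 0 hsτ]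
    rfl

/-- If laws converge weakly to a centred normal law, then the Fisher information of their Gaussian
smoothings converges. -/
theorem tendsto_lintegral_fisher_mixture (hτ : τ ≠ 0) {μs : ℕ → ProbabilityMeasure ℝ} {s : ℝ≥0}
    (h : Tendsto μs atTop (𝓝 (⟨gaussianReal 0 s, inferInstance⟩ : ProbabilityMeasure ℝ))) :
    Tendsto (fun n => ∫⁻ v, ENNReal.ofReal (mixture (gaussianDeriv τ) (μs n : Measure ℝ) v ^ 2 /
      mixture (gaussianPDFReal 0 τ) (μs n : Measure ℝ) v)) atTop
      (𝓝 (ENNReal.ofReal ((s : ℝ) + τ)⁻¹)) := by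
  have hsτ : s + τ ≠ 0 := by
    intro h0; exact hτ (add_eq_zero.1 h0).2
  have c0 := continuous_gaussianPDFReal 0 τ
  have c1 := continuous_gaussianDeriv τ
  have c2 := continuous_gaussianSqScore τ
  have m0 : ∀ μ : Measure ℝ, IsProbabilityMeasure μ → Measurable (mixture (gaussianPDFReal 0 τ) μ) :=
    fun μ _ => (continuous_mixture c0 (abs_gaussianPDFReal_le τ)).measurable
  have m1 : ∀ μ : Measure ℝ, IsProbabilityMeasure μ → Measurable (mixture (gaussianDeriv τ) μ) :=
    fun μ _ => (continuous_mixture c1 (abs_gaussianDeriv_le hτ)).measurable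
  have m2 : ∀ μ : Measure ℝ, IsProbabilityMeasure μ → Measurable (mixture (gaussianSqScore τ) μ) :=
    fun μ _ => (continuous_mixture c2 (abs_gaussianSqScore_le hτ)).measurable
  have key := tendsto_lintegral_of_le_of_tendsto (μ := volume) (c := ENNReal.ofReal (τ : ℝ)⁻¹)
    (h := fun n v => ENNReal.ofReal (mixture (gaussianDeriv τ) (μs n : Measure ℝ) v ^ 2 /
      mixture (gaussianPDFReal 0 τ) (μs n : Measure ℝ) v))
    (g := fun n v => ENNReal.ofReal (mixture (gaussianSqScore τ) (μs n : Measure ℝ) v))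
    (h' := fun v => ENNReal.ofReal (mixture (gaussianDeriv τ) (gaussianReal 0 s) v ^ 2 /
      mixture (gaussianPDFReal 0 τ) (gaussianReal 0 s) v))
    (g' := fun v => ENNReal.ofReal (mixture (gaussianSqScore τ) (gaussianReal 0 s) v))
    ENNReal.ofReal_ne_top
    (fun n => (((m1 _ inferInstance).pow_const 2).div (m0 _ inferInstance)).ennreal_ofReal)
    (fun n => (m2 _ inferInstance).ennreal_ofReal)
    (((m1 _ inferInstance).pow_const 2).div (m0 _ inferInstance)).ennreal_ofReal
    (fun n v => ENNReal.ofReal_le_ofReal (sq_mixture_div_le hτ v))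
    (fun v => ENNReal.ofReal_le_ofReal (sq_mixture_div_le hτ v))
    (fun v => ENNReal.ofReal_ne_top)
    (fun v => (ENNReal.continuous_ofReal.tendsto _).comp
      (((tendsto_mixture h c1 (abs_gaussianDeriv_le hτ) v).pow 2).div
        (tendsto_mixture h c0 (abs_gaussianPDFReal_le τ) v) (mixture_gaussian_pos hτ v).ne'))
    (fun v => (ENNReal.continuous_ofReal.tendsto _).comp
      (tendsto_mixture h c2 (abs_gaussianSqScore_le hτ) v))
    (fun n => (lintegral_mixture c2 (abs_gaussianSqScore_le hτ) (gaussianSqScore_nonneg τ)).trans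
      (lintegral_gaussianSqScore hτ))
    ((lintegral_mixture c2 (abs_gaussianSqScore_le hτ) (gaussianSqScore_nonneg τ)).trans
      (lintegral_gaussianSqScore hτ))
  convert key using 2
  rw [← NNReal.coe_add, ← lintegral_gaussianSqScore hsτ]
  refine lintegral_congr fun v => ?_
  rw [← deriv_mixture_gaussian hτ, mixture_gaussian_gaussianReal hτ,
    (hasDerivAt_gaussianPDFReal (s + τ) v).deriv]
  congr 1
  have := (gaussianPDFReal_pos 0 (s + τ) v hsτ).ne'
  rw [gaussianSqScore, gaussianDeriv]
  field_simp

end Kernels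

/-! ### Tails of second moments -/

/-- A continuous truncation of the square, vanishing outside `[-R, R]`. -/
noncomputable def truncSq (R z : ℝ) : ℝ := z ^ 2 * max 0 (min 1 (R - |z|))

theorem continuous_truncSq (R : ℝ) : Continuous (truncSq R) := by
  unfold truncSq
  fun_prop

theorem truncSq_nonneg (R z : ℝ) : 0 ≤ truncSq R z := mul_nonneg (sq_nonneg _) (le_max_left _ _)

theorem truncSq_le_sq (R z : ℝ) : truncSq R z ≤ z ^ 2 :=
  mul_le_of_le_one_right (sq_nonneg _) (max_le zero_le_one (min_le_left _ _))

theorem truncSq_eq_zero {R z : ℝ} (hz : R ≤ |z|) : truncSq R z = 0 := by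
  rw [truncSq, max_eq_left ((min_le_right _ _).trans (sub_nonpos.2 hz)), mul_zero]

theorem abs_truncSq_le (R z : ℝ) : |truncSq R z| ≤ R ^ 2 := by
  rw [abs_of_nonneg (truncSq_nonneg R z)]
  rcases le_total R |z| with hz | hz
  · rw [truncSq_eq_zero hz]; positivity
  · refine (truncSq_le_sq R z).trans ?_
    rw [← sq_abs z]
    gcongr

theorem tendsto_integral_truncSq :
    Tendsto (fun R => ∫ z, truncSq R z ∂gaussianReal 0 1) atTop (𝓝 1) := by
  have hv := variance_of_integral_eq_zero (μ := gaussianReal 0 1) (X := fun x => x)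
    (by fun_prop) integral_id_gaussianReal
  rw [variance_fun_id_gaussianReal, NNReal.coe_one] at hv
  rw [hv]
  refine tendsto_integral_filter_of_dominated_convergence (fun z => z ^ 2)
    (Eventually.of_forall fun R => (continuous_truncSq R).aestronglyMeasurable)
    (Eventually.of_forall fun R => ae_of_all _ fun z => ?_) ?_ (ae_of_all _ fun z => ?_)
  · rw [Real.norm_of_nonneg (truncSq_nonneg R z)]
    exact truncSq_le_sq R z
  · exact (memLp_id_gaussianReal' (μ := 0) (v := 1) 2 (by simp)).integrable_sq
  · refine tendsto_const_nhds.congr' ?_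
    filter_upwards [eventually_ge_atTop (|z| + 1)] with R hR
    rw [truncSq, min_eq_left (by linarith), max_eq_right zero_le_one, mul_one]

section Tail

variable {Ω : Type*} [MeasurableSpace Ω] {P : Measure Ω}

/-- The proportion of the second moment of a variable carried by its tail. -/
noncomputable def tailMoment (U : Ω → ℝ) (P : Measure Ω) (R : ℝ) : ℝ :=
  (∫ ω in {ω | R * √(Var[U; P]) ≤ |U ω|}, U ω ^ 2 ∂P) / Var[U; P]

theorem tailMoment_nonneg (U : Ω → ℝ) (R : ℝ) : 0 ≤ tailMoment U P R :=
  div_nonneg (integral_nonneg fun _ => sq_nonneg _) (variance_nonneg _ _)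

theorem tailMoment_antitone {U : Ω → ℝ} (hU : MemLp U 2 P) : Antitone (tailMoment U P) := by
  intro R S hRS
  refine div_le_div_of_nonneg_right (setIntegral_mono_set hU.integrable_sq.integrableOn
    (ae_of_all _ fun _ => sq_nonneg _) (Eventually.of_forall fun ω hω => ?_))
    (variance_nonneg _ _)
  exact (mul_le_mul_of_nonneg_right hRS (Real.sqrt_nonneg _)).trans hω

theorem tailMoment_le_one {U : Ω → ℝ} (hU : MemLp U 2 P) (hU0 : ∫ ω, U ω ∂P = 0) (R : ℝ) :
    tailMoment U P R ≤ 1 := by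
  refine div_le_one_of_le₀ ?_ (variance_nonneg _ _)
  rw [variance_of_integral_eq_zero hU.aestronglyMeasurable.aemeasurable hU0]
  exact setIntegral_le_integral hU.integrable_sq (ae_of_all _ fun _ => sq_nonneg _)

theorem tendsto_tailMoment {U : Ω → ℝ} (hm : Measurable U) (hU : MemLp U 2 P)
    (hpos : 0 < Var[U; P]) : Tendsto (tailMoment U P) atTop (𝓝 0) := by
  have hs : ∀ R : ℝ, MeasurableSet {ω | R * √(Var[U; P]) ≤ |U ω|} := fun R =>
    measurableSet_le measurable_const hm.abs
  have h1 : Tendsto (fun R : ℝ => ∫ ω in {ω | R * √(Var[U; P]) ≤ |U ω|}, U ω ^ 2 ∂P) atTop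
      (𝓝 (∫ _, (0 : ℝ) ∂P)) := by
    simp_rw [fun R => (integral_indicator (hs R) (f := fun ω => U ω ^ 2) (μ := P)).symm]
    refine tendsto_integral_filter_of_dominated_convergence (fun ω => U ω ^ 2)
      (Eventually.of_forall fun R => ((hm.pow_const 2).indicator (hs R)).aestronglyMeasurable)
      (Eventually.of_forall fun R => ae_of_all _ fun ω => ?_) hU.integrable_sq
      (ae_of_all _ fun ω => ?_)
    · refine (norm_indicator_le_norm_self _ _).trans_eq ?_
      exact Real.norm_of_nonneg (sq_nonneg _)
    · refine tendsto_const_nhds.congr' ?_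
      filter_upwards [eventually_gt_atTop (|U ω| / √(Var[U; P]))] with R hR
      rw [Set.indicator_of_notMem]
      simp only [Set.mem_ofPred_eq, not_le]
      exact (div_lt_iff₀ (Real.sqrt_pos.2 hpos)).1 hR
  have h2 := h1.div_const (Var[U; P])
  rw [integral_zero, zero_div] at h2
  exact h2

variable [IsProbabilityMeasure P]

/-- The standardised second moment is `1`, so whatever the truncation misses bounds the tail. The
truncated moment is the expectation of a bounded continuous function, hence visible to weak
convergence. -/
theorem tailMoment_le_one_sub {U : Ω → ℝ} (hm : Measurable U) (hU : MemLp U 2 P)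
    (hU0 : ∫ ω, U ω ∂P = 0) (hpos : 0 < Var[U; P]) (R : ℝ) :
    tailMoment U P R ≤ 1 - ∫ ω, truncSq R ((√(Var[U; P]))⁻¹ * U ω) ∂P := by
  set σ := √(Var[U; P]) with hσ
  have hσ0 : 0 < σ := Real.sqrt_pos.2 hpos
  have hσ2 : σ ^ 2 = Var[U; P] := Real.sq_sqrt hpos.le
  have hs : MeasurableSet {ω | R * σ ≤ |U ω|} := measurableSet_le measurable_const hm.abs
  have hti : Integrable (fun ω => truncSq R (σ⁻¹ * U ω)) P :=
    Integrable.of_bound (C := R ^ 2)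
      ((continuous_truncSq R).measurable.comp (hm.const_mul _)).aestronglyMeasurable
      (ae_of_all _ fun ω => abs_truncSq_le _ _)
  have h1 : ∫ ω in {ω | R * σ ≤ |U ω|}, U ω ^ 2 ∂P ≤
      ∫ ω, (U ω ^ 2 - σ ^ 2 * truncSq R (σ⁻¹ * U ω)) ∂P := by
    rw [← integral_indicator hs]
    refine integral_mono (hU.integrable_sq.indicator hs)
      (hU.integrable_sq.sub (hti.const_mul _)) fun ω => ?_
    by_cases hω : R * σ ≤ |U ω|
    · have : truncSq R (σ⁻¹ * U ω) = 0 := truncSq_eq_zero (by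
        rw [abs_mul, abs_of_pos (inv_pos.2 hσ0), inv_mul_eq_div, le_div_iff₀ hσ0]
        exact hω)
      simp only [this, mul_zero, sub_zero]
      exact Set.indicator_le_self' (fun _ _ => sq_nonneg _) ω
    · rw [Set.indicator_of_notMem (by simpa using hω)]
      have h2 := mul_le_mul_of_nonneg_left (truncSq_le_sq R (σ⁻¹ * U ω)) (sq_nonneg σ)
      have h3 : σ ^ 2 * (σ⁻¹ * U ω) ^ 2 = U ω ^ 2 := by field_simp
      simp only
      linarith
  rw [integral_sub hU.integrable_sq (hti.const_mul _), integral_const_mul,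
    ← variance_of_integral_eq_zero hm.aemeasurable hU0, ← hσ2] at h1
  rw [tailMoment, ← hσ, ← hσ2, div_le_iff₀ (by positivity)]
  linarith

end Tail

/-! ### The perturbed sums -/

instance isCountablyGenerated_largeBoxes (d : ℕ) : (largeBoxes d).IsCountablyGenerated :=
  inferInstanceAs (comap boxVolume atTop).IsCountablyGenerated

theorem exists_boxVolume_eq {d : ℕ} (hd : 0 < d) (n : ℕ) : ∃ x : Fin d → ℕ, boxVolume x = n := by
  classical
  refine ⟨Function.update 1 ⟨0, hd⟩ n, ?_⟩
  rw [boxVolume, Finset.prod_update_of_mem (Finset.mem_univ _)]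
  simp

/-- Neighbourhoods along `largeBoxes d` are uniform over all boxes of a given large volume. The
lower bound needs such a box to exist, as the supremum over an empty set is `⊥`; this is where `0 <
d` enters. -/
theorem tendsto_iSup_of_tendsto_largeBoxes {d : ℕ} (hd : 0 < d) {F : (Fin d → ℕ) → EReal} {a : EReal}
    (hF : Tendsto F (largeBoxes d) (𝓝 a)) :
    Tendsto (fun n : ℕ => ⨆ (x : Fin d → ℕ) (_ : boxVolume x = n), F x) atTop (𝓝 a) := by
  rw [tendsto_order] at hF ⊢
  constructor
  · intro b hb
    filter_upwards [eventually_comap.1 (hF.1 b hb)] with n hn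
    obtain ⟨x, hx⟩ := exists_boxVolume_eq hd n
    exact (hn x hx).trans_le (le_iSup₂ (f := fun x _ => F x) x hx)
  · intro b hb
    obtain ⟨c, hac, hcb⟩ := exists_between hb
    filter_upwards [eventually_comap.1 (hF.2 c hac)] with n hn
    exact (iSup₂_le fun x hx => (hn x hx).le).trans_lt hcb

theorem finite_boxVolume_lt (d N : ℕ) :
    {x : Fin d → ℕ | (∀ i, 0 < x i) ∧ boxVolume x < N}.Finite := by
  refine (Fintype.piFinset fun _ : Fin d => Finset.range N).finite_toSet.subset fun x hx => ?_
  simp only [Finset.mem_coe, Fintype.mem_piFinset, Finset.mem_range]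
  exact fun i => (Nat.le_of_dvd (boxVolume_pos hx.1)
    (Finset.dvd_prod_of_mem x (Finset.mem_univ i))).trans_lt hx.2

/-- `Z` is a family of independent `N(0, τ)` variables, independent of the field `X`. -/
structure IsPerturbation {d : ℕ} {Ω : Type*} [MeasurableSpace Ω] (X Z : (Fin d → ℤ) → Ω → ℝ)
    (τ : ℝ≥0) (P : Measure Ω) : Prop where
  meas : ∀ u, Measurable (Z u)
  law : ∀ u, P.map (Z u) = gaussianReal 0 τ
  indep : iIndepFun Z P
  indep_field : IndepFun (fun ω u => X u ω) (fun ω u => Z u ω) P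

/-- The normalised sum of the field over a box. -/
noncomputable def normSum {d : ℕ} {Ω : Type*} (X : (Fin d → ℤ) → Ω → ℝ) (x : Fin d → ℕ)
    (ω : Ω) : ℝ := (√(boxVolume x))⁻¹ * boxSum X x ω

theorem perturbedSum_eq {d : ℕ} {Ω : Type*} (X Z : (Fin d → ℤ) → Ω → ℝ) (x : Fin d → ℕ) :
    perturbedSum X Z x = fun ω => normSum X x ω + normSum Z x ω := by
  ext ω
  simp only [perturbedSum, normSum, boxSum, Finset.sum_add_distrib]
  ring

section Perturbed

variable {d : ℕ} {Ω : Type*} [MeasurableSpace Ω] {X Z : (Fin d → ℤ) → Ω → ℝ} {P : Measure Ω}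
  {τ : ℝ≥0}

theorem IsFKGSystem.measurable_normSum (h : IsFKGSystem X P) (x : Fin d → ℕ) :
    Measurable (normSum X x) := (h.measurable_boxSum x).const_mul _

theorem IsFKGSystem.memLp_normSum (h : IsFKGSystem X P) (x : Fin d → ℕ) :
    MemLp (normSum X x) 2 P := (h.memLp_boxSum x).const_mul _

theorem IsFKGSystem.variance_normSum (x : Fin d → ℕ) :
    Var[normSum X x; P] = siteVar X P x := by
  have : normSum X x = fun ω => (√(boxVolume x))⁻¹ * boxSum X x ω := rfl
  rw [this, variance_const_mul, inv_pow, Real.sq_sqrt (Nat.cast_nonneg _), siteVar]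
  ring

theorem IsFKGSystem.charFun_normSum (h : IsFKGSystem X P) (x : Fin d → ℕ) (t : ℝ) :
    charFun (P.map (normSum X x)) t = charFun (P.map (boxSum X x)) (t / √(boxVolume x)) := by
  have : normSum X x = fun ω => (√(boxVolume x))⁻¹ * boxSum X x ω := rfl
  rw [this, charFun_map_mul_comp (h.measurable_boxSum x).aemeasurable, inv_mul_eq_div]

theorem IsPerturbation.measurable_normSum (hZ : IsPerturbation X Z τ P) (x : Fin d → ℕ) :
    Measurable (normSum Z x) :=
  (Finset.measurable_fun_sum _ fun u _ => hZ.meas u).const_mul _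

theorem IsPerturbation.indepFun_normSum (hZ : IsPerturbation X Z τ P) (x : Fin d → ℕ) :
    IndepFun (normSum X x) (normSum Z x) P := by
  have hm : Measurable fun z : (Fin d → ℤ) → ℝ => (√(boxVolume x))⁻¹ * ∑ u ∈ box x, z u :=
    (Finset.measurable_fun_sum _ fun u _ => measurable_pi_apply u).const_mul _
  exact hZ.indep_field.comp hm hm

theorem measurable_perturbedSum (h : IsFKGSystem X P) (hZ : IsPerturbation X Z τ P)
    (x : Fin d → ℕ) : Measurable (perturbedSum X Z x) := by
  rw [perturbedSum_eq]
  exact (h.measurable_normSum x).add (hZ.measurable_normSum x)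

/-- The perturbed sum, standardised to unit variance. -/
noncomputable def stdSum (X Z : (Fin d → ℤ) → Ω → ℝ) (P : Measure Ω) (x : Fin d → ℕ)
    (ω : Ω) : ℝ := (√(Var[perturbedSum X Z x; P]))⁻¹ * perturbedSum X Z x ω

theorem measurable_stdSum (h : IsFKGSystem X P) (hZ : IsPerturbation X Z τ P) (x : Fin d → ℕ) :
    Measurable (stdSum X Z P x) := (measurable_perturbedSum h hZ x).const_mul _

variable [IsProbabilityMeasure P]

theorem IsFKGSystem.integral_normSum (h : IsFKGSystem X P) (x : Fin d → ℕ) :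
    ∫ ω, normSum X x ω ∂P = 0 := by
  simp only [normSum]
  rw [integral_const_mul, h.integral_boxSum, mul_zero]

theorem IsPerturbation.map_normSum (hZ : IsPerturbation X Z τ P) {x : Fin d → ℕ}
    (hx : ∀ i, 0 < x i) : P.map (normSum Z x) = gaussianReal 0 τ := by
  have hV : (boxVolume x : ℝ) ≠ 0 := by exact_mod_cast (boxVolume_pos hx).ne'
  have : IsProbabilityMeasure (P.map (normSum Z x)) :=
    Measure.isProbabilityMeasure_map (hZ.measurable_normSum x).aemeasurable
  refine Measure.ext_of_charFun (funext fun t => ?_)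
  have e : normSum Z x = fun ω => (√(boxVolume x))⁻¹ * ∑ u ∈ box x, Z u ω := rfl
  rw [e, charFun_map_mul_comp (Finset.measurable_fun_sum _ fun u _ => hZ.meas u).aemeasurable,
    (hZ.indep.restrict _).charFun_map_fun_finsetSum_eq_prod fun u _ => (hZ.meas u).aemeasurable]
  simp only [Finset.prod_apply, hZ.law, Finset.prod_const, card_box, charFun_gaussianReal]
  rw [← Complex.exp_nat_mul]
  congr 1
  have h2 : ((√(boxVolume x) : ℝ) : ℂ) ^ 2 = boxVolume x := by
    rw [← Complex.ofReal_pow, Real.sq_sqrt (Nat.cast_nonneg _), Complex.ofReal_natCast]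
  have hV' : (boxVolume x : ℂ) ≠ 0 := by exact_mod_cast hV
  push_cast
  rw [mul_pow, inv_pow, h2]
  field_simp
  ring

/-- The law of a perturbed sum is a Gaussian smoothing. -/
theorem map_perturbedSum (h : IsFKGSystem X P) (hZ : IsPerturbation X Z τ P) {x : Fin d → ℕ}
    (hx : ∀ i, 0 < x i) :
    P.map (perturbedSum X Z x) = P.map (normSum X x) ∗ gaussianReal 0 τ := by
  rw [perturbedSum_eq, ← hZ.map_normSum hx]
  exact (hZ.indepFun_normSum x).map_add_eq_map_conv_map₀ (h.measurable_normSum x).aemeasurable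
    (hZ.measurable_normSum x).aemeasurable

theorem IsPerturbation.memLp_normSum (hZ : IsPerturbation X Z τ P) {x : Fin d → ℕ}
    (hx : ∀ i, 0 < x i) : MemLp (normSum Z x) 2 P := by
  have hm := (hZ.measurable_normSum x).aemeasurable (μ := P)
  have := memLp_id_gaussianReal' (μ := 0) (v := τ) 2 (by simp)
  rw [← hZ.map_normSum hx, memLp_map_measure_iff (by fun_prop) hm] at this
  exact this

theorem memLp_perturbedSum (h : IsFKGSystem X P) (hZ : IsPerturbation X Z τ P) {x : Fin d → ℕ}
    (hx : ∀ i, 0 < x i) : MemLp (perturbedSum X Z x) 2 P := by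
  rw [perturbedSum_eq]
  exact (h.memLp_normSum x).add (hZ.memLp_normSum hx)

theorem integral_perturbedSum (h : IsFKGSystem X P) (hZ : IsPerturbation X Z τ P)
    {x : Fin d → ℕ} (hx : ∀ i, 0 < x i) : ∫ ω, perturbedSum X Z x ω ∂P = 0 := by
  have h1 : ∫ ω, normSum Z x ω ∂P = 0 := by
    have := integral_id_gaussianReal (μ := 0) (v := τ)
    rwa [← hZ.map_normSum hx, integral_map (hZ.measurable_normSum x).aemeasurable (by fun_prop)]
      at this
  rw [perturbedSum_eq, integral_add ((h.memLp_normSum x).integrable one_le_two)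
    ((hZ.memLp_normSum hx).integrable one_le_two), h.integral_normSum, h1, add_zero]

theorem variance_perturbedSum (h : IsFKGSystem X P) (hZ : IsPerturbation X Z τ P)
    {x : Fin d → ℕ} (hx : ∀ i, 0 < x i) : Var[perturbedSum X Z x; P] = siteVar X P x + τ := by
  have h1 : Var[normSum Z x; P] = τ := by
    rw [← variance_id_map (hZ.measurable_normSum x).aemeasurable, hZ.map_normSum hx,
      variance_id_gaussianReal]
  rw [perturbedSum_eq, (hZ.indepFun_normSum x).variance_fun_add (h.memLp_normSum x)
    (hZ.memLp_normSum hx), IsFKGSystem.variance_normSum, h1]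

theorem fisherInfo_perturbedSum (h : IsFKGSystem X P) (hZ : IsPerturbation X Z τ P) (hτ : τ ≠ 0)
    {x : Fin d → ℕ} (hx : ∀ i, 0 < x i) :
    fisherInfo (perturbedSum X Z x) P =
      ∫⁻ v, ENNReal.ofReal (mixture (gaussianDeriv τ) (P.map (normSum X x)) v ^ 2 /
        mixture (gaussianPDFReal 0 τ) (P.map (normSum X x)) v) := by
  have : IsProbabilityMeasure (P.map (normSum X x)) :=
    Measure.isProbabilityMeasure_map (h.measurable_normSum x).aemeasurable
  have hf := isSmoothDensity_mixture_gaussian (μ := P.map (normSum X x)) hτ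
  rw [← map_perturbedSum h hZ hx] at hf
  rw [fisherInfo_eq_lintegral (measurable_perturbedSum h hZ x) hf (mixture_gaussian_pos hτ),
    deriv_mixture_gaussian hτ]

/-! ### Convergence of the standardised Fisher information -/

/-- **Newman's central limit theorem** along boxes of growing volume. -/
theorem IsFKGSystem.tendsto_charFun_normSum_sub (h : IsFKGSystem X P) (t : ℝ) :
    Tendsto (fun x => charFun (P.map (normSum X x)) t
      - Complex.exp (-(t ^ 2 * siteVar X P x / 2 : ℝ))) (largeBoxes d) (𝓝 0) := by
  refine (tendsto_iff_ultrafilter _ _ _).2 fun U hU => ?_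
  obtain ⟨s, -, hs⟩ := h.exists_tendsto_siteVar U
  have h1 := h.tendsto_charFun_boxSum hU hs t
  have hc : Continuous fun r : ℝ => Complex.exp (-(t ^ 2 * r / 2 : ℝ)) := by fun_prop
  have h2 := h1.sub ((hc.tendsto s).comp hs)
  rw [sub_self] at h2
  refine h2.congr fun x => ?_
  rw [h.charFun_normSum, Function.comp]

/-- Along a subsequence where the variance per site tends to `s`, the factors tend to `s + τ` and `1
/ (s + τ)`. The product forgets `s`, so the whole family converges. -/
theorem tendsto_variance_mul_fisherInfo (h : IsFKGSystem X P) (hZ : IsPerturbation X Z τ P)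
    (hτ : τ ≠ 0) :
    Tendsto (fun x => ENNReal.ofReal (Var[perturbedSum X Z x; P]) *
      fisherInfo (perturbedSum X Z x) P) (largeBoxes d) (𝓝 1) := by
  refine tendsto_of_subseq_tendsto fun ns hns => ?_
  obtain ⟨s, hsmem, φ, hφ, hs⟩ := (isCompact_Icc (a := (0 : ℝ))
    (b := ∑' u, cov[X 0, X u; P])).tendsto_subseq
    (x := fun n => siteVar X P (ns n))
    (fun n => ⟨IsFKGSystem.siteVar_nonneg _, h.siteVar_le _⟩)
  refine ⟨φ, ?_⟩
  have hx : Tendsto (fun n => ns (φ n)) atTop (largeBoxes d) := hns.comp hφ.tendsto_atTop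
  let μs : ℕ → ProbabilityMeasure ℝ := fun n => ⟨P.map (normSum X (ns (φ n))),
    Measure.isProbabilityMeasure_map (h.measurable_normSum _).aemeasurable⟩
  have hsc : ((s.toNNReal : ℝ≥0) : ℝ) = s := Real.coe_toNNReal _ hsmem.1
  have hμ : Tendsto μs atTop
      (𝓝 (⟨gaussianReal 0 s.toNNReal, inferInstance⟩ : ProbabilityMeasure ℝ)) := by
    refine ProbabilityMeasure.tendsto_of_tendsto_charFun fun t => ?_
    have h1 := (h.tendsto_charFun_normSum_sub t).comp hx
    have hc : Continuous fun r : ℝ => Complex.exp (-(t ^ 2 * r / 2 : ℝ)) := by fun_prop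
    have h2 := h1.add ((hc.tendsto s).comp hs)
    have e : charFun (gaussianReal 0 s.toNNReal) t = Complex.exp (-(t ^ 2 * s / 2 : ℝ)) := by
      rw [charFun_gaussianReal, hsc]
      push_cast
      ring_nf
    simp only [ProbabilityMeasure.coe_mk, e]
    rw [zero_add] at h2
    refine h2.congr fun n => ?_
    simp [μs]
  have hF := tendsto_lintegral_fisher_mixture hτ hμ
  have hσ : Tendsto (fun n => ENNReal.ofReal (siteVar X P (ns (φ n)) + τ)) atTop
      (𝓝 (ENNReal.ofReal (s + τ))) :=
    (ENNReal.continuous_ofReal.tendsto _).comp (hs.add_const _)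
  have hpos : 0 < s + τ := by
    have : (0 : ℝ) < τ := by positivity
    linarith [hsmem.1]
  have hprod := ENNReal.Tendsto.mul hσ (Or.inr ENNReal.ofReal_ne_top) hF
    (Or.inr ENNReal.ofReal_ne_top)
  rw [hsc, ← ENNReal.ofReal_mul hpos.le, mul_inv_cancel₀ hpos.ne', ENNReal.ofReal_one] at hprod
  refine hprod.congr' ?_
  filter_upwards [hx (eventually_pos_largeBoxes d)] with n hn
  rw [variance_perturbedSum h hZ hn, fisherInfo_perturbedSum h hZ hτ hn]
  rfl

theorem tendsto_stdFisherInfo (h : IsFKGSystem X P) (hZ : IsPerturbation X Z τ P)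
    (hτ : τ ≠ 0) :
    Tendsto (fun x => stdFisherInfo (perturbedSum X Z x) P) (largeBoxes d) (𝓝 0) := by
  have h1 := (continuous_coe_ennreal_ereal.tendsto 1).comp (tendsto_variance_mul_fisherInfo h hZ hτ)
  have h2 : Tendsto (fun a : EReal => a - 1) (𝓝 1) (𝓝 (1 - 1)) := by
    have hc : ContinuousAt (fun p : EReal × EReal => p.1 + p.2) (1, -1) :=
      EReal.continuousAt_add (Or.inl (by decide)) (Or.inl (by decide))
    have := hc.tendsto.comp ((continuous_id.prodMk continuous_const).tendsto (1 : EReal))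
    exact this
  have e : (1 : EReal) - 1 = 0 := by
    rw [← EReal.coe_one, ← EReal.coe_sub, sub_self, EReal.coe_zero]
  rw [e] at h2
  exact h2.comp h1

/-! ### Uniform integrability -/

/-- With `θ = t / √(s + τ)`, the field contributes `exp (-θ² s / 2)` and the perturbation `exp (-θ²
τ / 2)`, whose product is `exp (-t² / 2)` for every `s`. Positivity of `τ` keeps the normalisation
away from zero. -/
theorem tendsto_charFun_stdSum (h : IsFKGSystem X P) (hZ : IsPerturbation X Z τ P) (hτ : τ ≠ 0)
    (t : ℝ) :
    Tendsto (fun x => charFun (P.map (stdSum X Z P x)) t) (largeBoxes d)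
      (𝓝 (charFun (gaussianReal 0 1) t)) := by
  refine (tendsto_iff_ultrafilter _ _ _).2 fun U hU => ?_
  obtain ⟨s, hs0, hs⟩ := h.exists_tendsto_siteVar U
  have hpos : 0 < s + τ := by
    have : (0 : ℝ) < τ := by positivity
    linarith
  have hσ : Tendsto (fun x => (√(siteVar X P x + τ))⁻¹ * t) U (𝓝 ((√(s + τ))⁻¹ * t)) :=
    (((Real.continuous_sqrt.tendsto _).comp (hs.add_const _)).inv₀
      (Real.sqrt_ne_zero'.2 hpos)).mul_const t
  have h1 := h.tendsto_charFun_boxSum_of_tendsto hU hs hσ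
  have hc : Continuous fun r : ℝ => charFun (gaussianReal 0 τ) r := by fun_prop
  have h2 := h1.mul ((hc.tendsto _).comp hσ)
  have e : Complex.exp (-((((√(s + τ))⁻¹ * t) ^ 2 * s / 2 : ℝ) : ℂ))
      * charFun (gaussianReal 0 τ) ((√(s + τ))⁻¹ * t) = charFun (gaussianReal 0 1) t := by
    rw [charFun_gaussianReal, charFun_gaussianReal, ← Complex.exp_add]
    congr 1
    have h3 : ((√(s + τ))⁻¹ * t) ^ 2 * (s + τ) = t ^ 2 := by
      rw [mul_pow, inv_pow, Real.sq_sqrt hpos.le]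
      field_simp
    have h4 : (((√(s + τ))⁻¹ * t : ℝ) : ℂ) ^ 2 * (s + τ) = t ^ 2 := by exact_mod_cast h3
    push_cast at h4 ⊢
    linear_combination (-1 / 2 : ℂ) * h4
  rw [e] at h2
  refine h2.congr' ?_
  filter_upwards [hU (eventually_pos_largeBoxes d)] with x hx
  have e2 : stdSum X Z P x = fun ω => (√(siteVar X P x + τ))⁻¹ * perturbedSum X Z x ω := by
    ext ω; rw [stdSum, variance_perturbedSum h hZ hx]
  rw [e2, charFun_map_mul_comp (measurable_perturbedSum h hZ x).aemeasurable,
    map_perturbedSum h hZ hx, charFun_conv, h.charFun_normSum]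
  rfl

theorem tendsto_integral_stdSum (h : IsFKGSystem X P) (hZ : IsPerturbation X Z τ P) (hτ : τ ≠ 0)
    {g : ℝ → ℝ} (hg : Continuous g) {C : ℝ} (hC : ∀ z, |g z| ≤ C) :
    Tendsto (fun x => ∫ ω, g (stdSum X Z P x ω) ∂P) (largeBoxes d)
      (𝓝 (∫ z, g z ∂gaussianReal 0 1)) := by
  refine tendsto_of_seq_tendsto fun ns hns => ?_
  let μs : ℕ → ProbabilityMeasure ℝ := fun n => ⟨P.map (stdSum X Z P (ns n)),
    Measure.isProbabilityMeasure_map (measurable_stdSum h hZ _).aemeasurable⟩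
  have hμ : Tendsto μs atTop
      (𝓝 (⟨gaussianReal 0 1, inferInstance⟩ : ProbabilityMeasure ℝ)) :=
    ProbabilityMeasure.tendsto_of_tendsto_charFun fun t =>
      (tendsto_charFun_stdSum h hZ hτ t).comp hns
  have := ProbabilityMeasure.tendsto_iff_forall_integral_tendsto.1 hμ
    (BoundedContinuousFunction.ofNormedAddCommGroup g hg C hC)
  refine this.congr fun n => ?_
  exact integral_map (measurable_stdSum h hZ _).aemeasurable hg.aestronglyMeasurable

theorem exists_memClass_perturbedSum (h : IsFKGSystem X P) (hZ : IsPerturbation X Z τ P)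
    (hτ : τ ≠ 0) :
    ∃ ψ : ℝ → ℝ, Tendsto ψ atTop (𝓝 0) ∧
      ∀ x : Fin d → ℕ, (∀ i, 0 < x i) → MemClass ψ (perturbedSum X Z x) P := by
  have hvar : ∀ x : Fin d → ℕ, (∀ i, 0 < x i) → 0 < Var[perturbedSum X Z x; P] := by
    intro x hx
    rw [variance_perturbedSum h hZ hx]
    have h1 : (0 : ℝ) < τ := by positivity
    have h2 := IsFKGSystem.siteVar_nonneg (X := X) (P := P) x
    linarith
  let T : {x : Fin d → ℕ // ∀ i, 0 < x i} → ℝ → ℝ := fun x => tailMoment (perturbedSum X Z x) P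
  have hbdd : ∀ R, BddAbove (Set.range fun x => T x R) := fun R =>
    ⟨1, by
      rintro _ ⟨x, rfl⟩
      exact tailMoment_le_one (memLp_perturbedSum h hZ x.2) (integral_perturbedSum h hZ x.2) R⟩
  have hne : Nonempty {x : Fin d → ℕ // ∀ i, 0 < x i} := ⟨⟨fun _ => 1, fun _ => one_pos⟩⟩
  -- The smallest possible `ψ`: the supremum over boxes of the normalised tail moments.
  refine ⟨fun R => ⨆ x, T x R, ?_, fun x hx => ⟨memLp_perturbedSum h hZ hx, fun R => ?_⟩⟩
  · rw [Metric.tendsto_nhds]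
    intro ε hε
    -- `R₀` depends only on the normal law: its truncated second moment exceeds `1 - ε / 2`, and
    -- weak convergence transfers this to all boxes of volume at least `N`. Monotonicity of the
    -- tails then covers `R ≥ R₀`.
    obtain ⟨R₀, hR₀⟩ := (tendsto_integral_truncSq.eventually_const_lt
      (show 1 - ε / 2 < 1 by linarith)).exists
    have hlarge := (tendsto_integral_stdSum h hZ hτ (continuous_truncSq R₀)
      (abs_truncSq_le R₀)).eventually_const_lt hR₀
    obtain ⟨N, hN⟩ := eventually_atTop.1 (eventually_comap.1 hlarge)
    have hsmall : ∀ᶠ R in atTop, ∀ x ∈ {x : Fin d → ℕ | (∀ i, 0 < x i) ∧ boxVolume x < N},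
        tailMoment (perturbedSum X Z x) P R < ε / 2 :=
      ((finite_boxVolume_lt d N).eventually_all).2 fun x hx =>
        (tendsto_tailMoment (measurable_perturbedSum h hZ x) (memLp_perturbedSum h hZ hx.1)
          (hvar x hx.1)).eventually_lt_const (by linarith)
    filter_upwards [hsmall, eventually_ge_atTop R₀] with R hR hRR₀
    rw [Real.dist_eq, sub_zero, abs_of_nonneg (Real.iSup_nonneg fun x => tailMoment_nonneg _ _)]
    refine (ciSup_le fun x => ?_).trans_lt (half_lt_self hε)
    rcases lt_or_ge (boxVolume x.1) N with hx | hx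
    · exact (hR x.1 ⟨x.2, hx⟩).le
    · have h1 := tailMoment_antitone (memLp_perturbedSum h hZ x.2) hRR₀
      have h2 := tailMoment_le_one_sub (measurable_perturbedSum h hZ x.1)
        (memLp_perturbedSum h hZ x.2) (integral_perturbedSum h hZ x.2) (hvar x.1 x.2) R₀
      have h3 := hN _ hx x.1 rfl
      simp only [stdSum] at h3
      exact h1.trans (by linarith)
  · have h1 := le_ciSup (hbdd R) ⟨x, hx⟩
    have h2 : T ⟨x, hx⟩ R * Var[perturbedSum X Z x; P] =
        ∫ ω in {ω | R * √(Var[perturbedSum X Z x; P]) ≤ |perturbedSum X Z x ω|},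
          perturbedSum X Z x ω ^ 2 ∂P := div_mul_cancel₀ _ (hvar x hx).ne'
    rw [← h2, mul_comm]
    exact mul_le_mul_of_nonneg_left h1 (hvar x hx).le

end Perturbed

end FKGField

/-- The equivalence of convergence in Fisher information and uniform integrability for perturbed
finitely susceptible FKG fields. Newman's central limit theorem, along boxes of arbitrary shape and
growing volume, yields each of the two properties: the Gaussian perturbation upgrades weak
convergence to convergence of the Fisher information, and the convergence of the variances
upgrades it to uniform integrability. -/
theorem theorem1p7 {d : ℕ} (hd : 0 < d)
    {Ω : Type*} [MeasurableSpace Ω] (P : Measure Ω) [IsProbabilityMeasure P]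
    (X Z : (Fin d → ℤ) → Ω → ℝ) (τ : ℝ≥0) (hτ : 0 < τ)
    -- the field: stationary, mean zero, finite variance, FKG, finite susceptibility
    (hXmeas : ∀ u, Measurable (X u))
    (hXstat : FKGField.IsStationary X P)
    (hXvar : ∀ u, MemLp (X u) 2 P)
    (hXmean : ∀ u, ∫ ω, X u ω ∂P = 0)
    (hXfkg : FKGField.IsFKG X P)
    (hXsus : Summable fun u : Fin d → ℤ => cov[X 0, X u; P])
    -- the perturbation: `Z u ∼ N(0, τ)`, independent of each other and of the field
    (hZmeas : ∀ u, Measurable (Z u))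
    (hZlaw : ∀ u, P.map (Z u) = gaussianReal 0 τ)
    (hZindep : iIndepFun Z P)
    (hXZ : IndepFun (fun ω u => X u ω) (fun ω u => Z u ω) P) :
    Tendsto (fun n : ℕ => ⨆ (x : Fin d → ℕ) (_ : FKGField.boxVolume x = n),
        FKGField.stdFisherInfo (FKGField.perturbedSum X Z x) P) atTop (𝓝 (0 : EReal)) ↔
      ∃ ψ : ℝ → ℝ, Tendsto ψ atTop (𝓝 0) ∧
        ∀ x : Fin d → ℕ, (∀ i, 0 < x i) →
          FKGField.MemClass ψ (FKGField.perturbedSum X Z x) P := by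
  have h : FKGField.IsFKGSystem X P := ⟨hXmeas, hXstat, hXvar, hXmean, hXfkg, hXsus⟩
  have hZ : FKGField.IsPerturbation X Z τ P := ⟨hZmeas, hZlaw, hZindep, hXZ⟩
  exact ⟨fun _ => FKGField.exists_memClass_perturbedSum h hZ hτ.ne',
    fun _ => FKGField.tendsto_iSup_of_tendsto_largeBoxes hd
      (FKGField.tendsto_stdFisherInfo h hZ hτ.ne')⟩
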